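/- **Setup.** Fix a non-principal ultrafilter $\mathcal F$ on the set $\mathcal P$ of prime numbers and a ring isomorphism $\alpha:\operatorname{ulim}_p\overline{\mathbb F_p}\cong\mathbb C$, where $\operatorname{ulim}_p$ denotes the ultraproduct with respect to $\mathcal F$; "for almost all $p$" means for all $p$ in some member of $\mathcal F$. Let ${}^*\mathbb N=\operatorname{ulim}_p\mathbb N$ and $\pi=\operatorname{ulim}_p p\in{}^*\mathbb N$; powers and $\lceil\cdot\rceil$ of hyperreal numbers are taken componentwise. A local ring $R$ essentially of finite type over $\mathbb C$ is written as $R\cong(\mathbb C[x_1,\dots,x_n]/I)_P$ with $P$ prime. Let $I_p,P_p\subseteq\overline{\mathbb F_p}[x_1,\dots,x_n]$ be generated by approximations of finitely many generators of $I$ and $P$, where a family $(g_p)$ approximates $g\in\mathbb C[x_1,\dots,x_n]$ if $\operatorname{ulim}_pg_p$ is the image of $g$ in $\operatorname{ulim}_p\overline{\mathbb F_p}[x_1,\dots,x_n]$ under the map that is $\alpha^{-1}$ on constants and sends $x_i$ to $x_i$. An approximation of $R$ is $(R_p)_p$ with $R_p=(\overline{\mathbb F_p}[x_1,\dots,x_n]/I_p)_{P_p}$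 for almost all $p$. Put $R_\infty=\operatorname{ulim}_pR_p$, with the canonical map $R\to R_\infty$. A family $(r_p)$ approximates $r\in R$ if $\operatorname{ulim}_pr_p$ is the image of $r$; an approximation $(\mathfrak a_p)$ of an ideal $\mathfrak a$ is generated, for almost all $p$, by approximations of finitely many generators of $\mathfrak a$. An approximation of a $\mathbb C$-algebra homomorphism $\varphi:R\to S$ of such rings is a family of maps $\varphi_p:R_p\to S_p$, being $\overline{\mathbb F_p}$-algebra homomorphisms for almost all $p$, taking approximations of any $r\in R$ to approximations of $\varphi(r)$; $\mathfrak a_pS_p$ is the ideal of $S_p$ generated by $\varphi_p(\mathfrak a_p)$. A homomorphism of $A$-modules (or a ring homomorphism $A\to B$) is pure if it remains injective after tensoring over $A$ with any $A$-module. For a ring $A$ of characteristic $p$, an ideal $\mathfrak b$ and a real $t>0$, the pair $(A,\mathfrak b^t)$ is sharply $F$-pure if for infinitely many $e\in\mathbb N$ there is $f\in\mathfrak b^{\lceil t(p^e-1)\rceil}$ such that $A\to F^e_*A$, $x\mapsto f x^{p^e}$, is pure. For $\varepsilon=\operatorname{ulim}_pe_p\in{}^*\mathbb N$ let $F^\varepsilon:R\to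 R_\infty$ be $x\mapsto\operatorname{ulim}_px_p^{p^{e_p}}$, where $(x_p)$ approximates $x$; for $f\in R_\infty$, "$fF^\varepsilon:R\to R_\infty$ is pure" means that $x\mapsto fF^\varepsilon(x)$ is pure as an $R$-linear map to $R_\infty$ regarded as an $R$-module through $F^\varepsilon$. For $\nu=\operatorname{ulim}_pn_p\in{}^*\mathbb N$ put $\mathfrak a^\nu=\operatorname{ulim}_p\mathfrak a_p^{n_p}\subseteq R_\infty$ and $x^\nu=\operatorname{ulim}_px_p^{n_p}$. The pair $(R,\mathfrak a^t)$ is sharply ultra-$F$-pure if for every $\varepsilon_0\in{}^*\mathbb N$ there are $\varepsilon\ge\varepsilon_0$ in ${}^*\mathbb N$ and $f\in\mathfrak a^{\lceil t(\pi^\varepsilon-1)\rceil}$ such that $fF^\varepsilon:R\to R_\infty$ is pure. **Statement.** Let $R$ be a reduced local ring essentially of finite type over $\mathbb C$, $\mathfrak a\subseteq R$ an ideal not contained in the union of the minimal primes of $R$, and $t>0$ a real number. Let $(R_p)$ and $(\mathfrak a_p)$ be approximations of $R$ and $\mathfrak a$. 1. Suppose that $(R_p,\mathfrak a_p^t)$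 is sharply $F$-pure for almost all $p$. Then for any generators $f_1,\dots,f_n$ of $\mathfrak a$ and any $\varepsilon_0\in{}^*\mathbb N$ there exist $\varepsilon\ge\varepsilon_0$ and $\mu_1,\dots,\mu_n\in{}^*\mathbb N$ with $\mu_1+\dots+\mu_n=\lceil t(\pi^\varepsilon-1)\rceil$ such that $fF^\varepsilon:R\to R_\infty$ is pure, where $f=\prod_{i=1}^nf_i^{\mu_i}$. In particular, $(R,\mathfrak a^t)$ is sharply ultra-$F$-pure. 2. Let $R\to S$ be a pure local $\mathbb C$-algebra homomorphism to a reduced local ring $S$ essentially of finite type over $\mathbb C$, and let $(S_p)$ and $(R_p\to S_p)$ be approximations of $S$ and of $R\to S$. If $(S_p,(\mathfrak a_pS_p)^t)$ is sharply $F$-pure for almost all $p$, then $(R,\mathfrak a^t)$ is sharply ultra-$F$-pure. -/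

import Mathlib

open Filter

open scoped TensorProduct

universe u v

/-! ## Purity -/

/-- For a ring homomorphism `φ : A → B` and `c : B`, the map `A → φ_* B`, `x ↦ c * φ x`, is a
homomorphism of `A`-modules, where `φ_* B` is `B` regarded as an `A`-module through `φ`.
This says that it is pure: it stays injective after tensoring with any `A`-module. -/
def IsPureTwist {A : Type u} {B : Type v} [CommRing A] [CommRing B]
    (φ : A →+* B) (c : B) : Prop :=
  letI : Module A B := Module.compHom B φ
  ∀ (M : Type u) [AddCommGroup M] [Module A M],
    Function.Injective (LinearMap.lTensor M (LinearMap.toSpanSingleton A B c))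

/-- A ring homomorphism `A → B` is pure if `M → M ⊗ B` is injective for every `A`-module `M`. -/
def IsPureRingHom {A : Type u} {B : Type v} [CommRing A] [CommRing B] (φ : A →+* B) : Prop :=
  IsPureTwist φ 1

/-! ## Sharp `F`-purity in characteristic `p` -/

/-- The `e`-th iterated Frobenius `x ↦ x ^ (p ^ e)` of a ring in which `p = 0`. -/
def frobPow (p : ℕ) [Fact p.Prime] (A : Type u) [CommRing A] [Algebra (ZMod p) A] (e : ℕ) :
    A →+* A where
  toFun x := x ^ p ^ e
  map_one' := one_pow _
  map_mul' x y := mul_pow x y _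
  map_zero' := zero_pow (pow_ne_zero _ (Fact.out : p.Prime).ne_zero)
  map_add' x y := by
    rcases subsingleton_or_nontrivial A with h | h
    · exact Subsingleton.elim _ _
    · have : CharP A p := charP_of_injective_algebraMap (algebraMap (ZMod p) A).injective p
      exact add_pow_char_pow x y p e

/-- `(A, 𝔞^t)` is sharply `F`-pure: for infinitely many `e` there is
`f ∈ 𝔞 ^ ⌈t (p ^ e - 1)⌉` such that `A → F^e_* A`, `x ↦ f * x ^ (p ^ e)`, is pure. -/
def IsSharplyFPure (p : ℕ) [Fact p.Prime] (A : Type u) [CommRing A] [Algebra (ZMod p) A]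
    (a : Ideal A) (t : ℝ) : Prop :=
  {e : ℕ | ∃ f ∈ a ^ ⌈t * ((p : ℝ) ^ e - 1)⌉₊, IsPureTwist (frobPow p A e) f}.Infinite

/-! ## Ultraproducts of rings indexed by the prime numbers -/

instance factPrimes (p : Nat.Primes) : Fact (p : ℕ).Prime := ⟨p.2⟩

/-- The ideal of sequences that vanish for almost all `p`. -/
def ultraIdeal (F : Ultrafilter Nat.Primes) (A : Nat.Primes → Type u) [∀ p, CommRing (A p)] :
    Ideal (∀ p, A p) where
  carrier := {x | ∀ᶠ p in (F : Filter Nat.Primes), x p = 0}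
  zero_mem' := Eventually.of_forall fun _ => rfl
  add_mem' {x y} hx hy := by
    filter_upwards [hx, hy] with p h1 h2
    simp [h1, h2]
  smul_mem' c x hx := by
    filter_upwards [hx] with p h1
    simp [h1]

/-- The ultraproduct of a family of rings: sequences modulo equality for almost all `p`. -/
abbrev Ulim (F : Ultrafilter Nat.Primes) (A : Nat.Primes → Type u) [∀ p, CommRing (A p)] :
    Type u :=
  (∀ p, A p) ⧸ ultraIdeal F A

/-- The class of a sequence in the ultraproduct. -/
abbrev ulim (F : Ultrafilter Nat.Primes) {A : Nat.Primes → Type u} [∀ p, CommRing (A p)] :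
    (∀ p, A p) →+* Ulim F A :=
  Ideal.Quotient.mk (ultraIdeal F A)

theorem ulim_eq_iff (F : Ultrafilter Nat.Primes) {A : Nat.Primes → Type u}
    [∀ p, CommRing (A p)] {x y : ∀ p, A p} :
    ulim F x = ulim F y ↔ ∀ᶠ p in (F : Filter Nat.Primes), x p = y p := by
  rw [Ideal.Quotient.eq]
  change (∀ᶠ p in (F : Filter Nat.Primes), (x - y) p = 0) ↔ _
  simp only [Pi.sub_apply, sub_eq_zero]

/-- The ultraproduct of a family of ring homomorphisms. -/
def ulimMap (F : Ultrafilter Nat.Primes) {A : Nat.Primes → Type u} {B : Nat.Primes → Type v}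
    [∀ p, CommRing (A p)] [∀ p, CommRing (B p)] (φ : ∀ p, A p →+* B p) : Ulim F A →+* Ulim F B :=
  Ideal.Quotient.lift (ultraIdeal F A)
    ((ulim F).comp (RingHom.pi fun p => (φ p).comp (Pi.evalRingHom A p))) (by
      intro x hx
      rw [← map_zero (ulim F), RingHom.comp_apply, ulim_eq_iff]
      filter_upwards [(hx : ∀ᶠ p in (F : Filter Nat.Primes), x p = 0)] with p hp
      change φ p (x p) = 0
      rw [hp, map_zero])

theorem ulimMap_ulim (F : Ultrafilter Nat.Primes) {A : Nat.Primes → Type u}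
    {B : Nat.Primes → Type v} [∀ p, CommRing (A p)] [∀ p, CommRing (B p)]
    (φ : ∀ p, A p →+* B p) (x : ∀ p, A p) :
    ulimMap F φ (ulim F x) = ulim F (fun p => φ p (x p)) := rfl

/-! ## Hypernatural numbers and internal powers -/

/-- The hypernatural numbers, i.e. the ultrapower of `ℕ`, with the induced order. -/
abbrev HyperNat (F : Ultrafilter Nat.Primes) : Type := Germ (F : Filter Nat.Primes) ℕ

/-- `π ^ ε`, where `π` is the class of the sequence `p ↦ p`. -/
def hyperPrimePow (F : Ultrafilter Nat.Primes) (ε : HyperNat F) : HyperNat F :=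
  Germ.map₂ (fun p e : ℕ => p ^ e) ((fun p : Nat.Primes => (p : ℕ)) : HyperNat F) ε

/-- `⌈t (π ^ ε - 1)⌉`. -/
noncomputable def hyperExponent (F : Ultrafilter Nat.Primes) (t : ℝ) (ε : HyperNat F) :
    HyperNat F :=
  Germ.map (fun q : ℕ => ⌈t * ((q : ℝ) - 1)⌉₊) (hyperPrimePow F ε)

/-- The internal power `x ^ ν` of an element of an ultraproduct with a hypernatural exponent:
`(ulim x_p) ^ (ulim n_p) = ulim (x_p ^ n_p)`. -/
def hyperPow {F : Ultrafilter Nat.Primes} {A : Nat.Primes → Type u} [∀ p, CommRing (A p)]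
    (x : Ulim F A) (ν : HyperNat F) : Ulim F A :=
  Quotient.liftOn₂' x ν (fun a (n : Nat.Primes → ℕ) => ulim F (fun p => a p ^ n p)) (by
    intro a n b m hab hnm
    have hab' : ∀ᶠ p in (F : Filter Nat.Primes), a p = b p := by
      rw [← ulim_eq_iff F]
      exact Quotient.sound' hab
    rw [ulim_eq_iff]
    filter_upwards [hab', (hnm : n =ᶠ[(F : Filter Nat.Primes)] m)] with p h1 h2
    rw [h1, h2])

theorem hyperPow_ulim (F : Ultrafilter Nat.Primes) {A : Nat.Primes → Type u}
    [∀ p, CommRing (A p)] (a : ∀ p, A p) (n : Nat.Primes → ℕ) :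
    hyperPow (ulim F a) (n : HyperNat F) = ulim F (fun p => a p ^ n p) := rfl

/-- The internal power `ulim 𝔞_p ^ {n_p}` of a family of ideals, for `ν = ulim n_p`. -/
def idealHyperPow {F : Ultrafilter Nat.Primes} {A : Nat.Primes → Type u} [∀ p, CommRing (A p)]
    (a : ∀ p, Ideal (A p)) (ν : HyperNat F) : Set (Ulim F A) :=
  {f | ∃ (n : Nat.Primes → ℕ) (g : ∀ p, A p), ν = (n : HyperNat F) ∧ f = ulim F g ∧
    ∀ᶠ p in (F : Filter Nat.Primes), g p ∈ a p ^ n p}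

/-- The ultra-Frobenius `ulim x_p ↦ ulim (x_p ^ (p ^ e_p))` on an ultraproduct of rings `A_p`
of characteristic `p`, for `ε = ulim e_p`. -/
def ultraFrob {F : Ultrafilter Nat.Primes} {A : Nat.Primes → Type u} [∀ p, CommRing (A p)]
    [∀ p : Nat.Primes, Algebra (ZMod (p : ℕ)) (A p)] (ε : HyperNat F) : Ulim F A →+* Ulim F A where
  toFun x := hyperPow x (hyperPrimePow F ε)
  map_one' := by
    induction ε using Germ.inductionOn with | _ e =>
    exact (ulim_eq_iff F).2 (Eventually.of_forall fun p => one_pow _)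
  map_zero' := by
    induction ε using Germ.inductionOn with | _ e =>
    exact (ulim_eq_iff F).2 (Eventually.of_forall fun p => map_zero (frobPow p (A p) (e p)))
  map_mul' x y := by
    induction ε using Germ.inductionOn with | _ e =>
    obtain ⟨x, rfl⟩ := Ideal.Quotient.mk_surjective x
    obtain ⟨y, rfl⟩ := Ideal.Quotient.mk_surjective y
    exact (ulim_eq_iff F).2 (Eventually.of_forall fun p => mul_pow (x p) (y p) _)
  map_add' x y := by
    induction ε using Germ.inductionOn with | _ e =>
    obtain ⟨x, rfl⟩ := Ideal.Quotient.mk_surjective x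
    obtain ⟨y, rfl⟩ := Ideal.Quotient.mk_surjective y
    exact (ulim_eq_iff F).2
      (Eventually.of_forall fun p => map_add (frobPow p (A p) (e p)) (x p) (y p))

/-! ## Approximations -/

/-- An algebraic closure of the field with `p` elements. -/
abbrev FpBar (p : Nat.Primes) : Type := AlgebraicClosure (ZMod (p : ℕ))

/-- Let `ι` map a ring `R` to the ultraproduct of rings `A_p`. A family of ideals `J_p` of `A_p`
is an approximation of the ideal `J` of `R` if there are finitely many generators of `J` and
approximations of them such that, for almost all `p`, the latter generate `J_p`. -/
def IsIdealApprox {F : Ultrafilter Nat.Primes} {R : Type v} [CommRing R]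
    {A : Nat.Primes → Type u} [∀ p, CommRing (A p)] (ι : R →+* Ulim F A)
    (J : Ideal R) (Jp : ∀ p, Ideal (A p)) : Prop :=
  ∃ (m : ℕ) (g : Fin m → R) (gp : Fin m → ∀ p, A p),
    Ideal.span (Set.range g) = J ∧ (∀ j, ulim F (gp j) = ι (g j)) ∧
      ∀ᶠ p in (F : Filter Nat.Primes), Jp p = Ideal.span (Set.range fun j => gp j p)

section Approximation

variable (F : Ultrafilter Nat.Primes) (α : Ulim F FpBar ≃+* ℂ)

/-- The canonical homomorphism from `ℂ[x_1, …, x_n]` to its non-standard hull, the ultraproduct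
of the polynomial rings over the fields `FpBar p`. -/
noncomputable def polyHull (n : ℕ) :
    MvPolynomial (Fin n) ℂ →+* Ulim F (fun p => MvPolynomial (Fin n) (FpBar p)) :=
  MvPolynomial.eval₂Hom
    ((ulimMap F fun p => (MvPolynomial.C : FpBar p →+* MvPolynomial (Fin n) (FpBar p))).comp
      α.symm.toRingHom)
    (fun i => ulim F (fun _ => MvPolynomial.X i))

/-- A choice of the data from which an approximation of a local ring `R` essentially of finite
type over `ℂ` is formed. The elements `x_1, …, x_n` of `R` present `R` as the localization of
`ℂ[x_1, …, x_n] / I` at the prime `P / I`, where `I` is the kernel of `X_i ↦ x_i` and `P` is the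
preimage of the maximal ideal of `R`; `I_p` and `P_p` are approximations of `I` and `P`. -/
structure LocalApprox (R : Type u) [CommRing R] [IsLocalRing R] [Algebra ℂ R] where
  n : ℕ
  x : Fin n → R
  frac : ∀ r : R, ∃ f s : MvPolynomial (Fin n) ℂ, IsUnit (MvPolynomial.aeval x s) ∧
    r * MvPolynomial.aeval x s = MvPolynomial.aeval x f
  I : ∀ p : Nat.Primes, Ideal (MvPolynomial (Fin n) (FpBar p))
  P : ∀ p : Nat.Primes, Ideal (MvPolynomial (Fin n) (FpBar p))
  approx_I : IsIdealApprox (polyHull F α n) (RingHom.ker (MvPolynomial.aeval (R := ℂ) x)) I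
  approx_P : IsIdealApprox (polyHull F α n)
    ((IsLocalRing.maximalIdeal R).comap (MvPolynomial.aeval (R := ℂ) x)) P

namespace LocalApprox

variable {F α} {R : Type u} [CommRing R] [IsLocalRing R] [Algebra ℂ R] (X : LocalApprox F α R)

/-- The submonoid generated by the complement of `P_p`; it is the complement of `P_p` itself when
`P_p` is prime, see `denom_eq`. -/
noncomputable def denom (p : Nat.Primes) : Submonoid (MvPolynomial (Fin X.n) (FpBar p)) :=
  Submonoid.closure ((X.P p : Set (MvPolynomial (Fin X.n) (FpBar p)))ᶜ)

theorem denom_eq (p : Nat.Primes) (h : (X.P p).IsPrime) : X.denom p = (X.P p).primeCompl :=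
  Submonoid.closure_eq (X.P p).primeCompl

/-- The member `R_p` of the approximation of `R`: the localization of
`FpBar p [x_1, …, x_n] / I_p` at `P_p`. -/
def ring (p : Nat.Primes) : Type :=
  Localization ((X.denom p).map (Ideal.Quotient.mk (X.I p)))

noncomputable instance (p : Nat.Primes) : CommRing (X.ring p) :=
  inferInstanceAs (CommRing (Localization ((X.denom p).map (Ideal.Quotient.mk (X.I p)))))

noncomputable instance (p : Nat.Primes) : Algebra (FpBar p) (X.ring p) :=
  inferInstanceAs (Algebra (FpBar p) (Localization ((X.denom p).map (Ideal.Quotient.mk (X.I p)))))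

noncomputable instance (p : Nat.Primes) : Algebra (ZMod (p : ℕ)) (X.ring p) :=
  ((algebraMap (FpBar p) (X.ring p)).comp (algebraMap (ZMod (p : ℕ)) (FpBar p))).toAlgebra

/-- The canonical homomorphism `FpBar p [x_1, …, x_n] → R_p`. -/
noncomputable def toRing (p : Nat.Primes) : MvPolynomial (Fin X.n) (FpBar p) →+* X.ring p :=
  (algebraMap (MvPolynomial (Fin X.n) (FpBar p) ⧸ X.I p)
    (Localization ((X.denom p).map (Ideal.Quotient.mk (X.I p))))).comp
    (Ideal.Quotient.mk (X.I p))

/-- The canonical homomorphism `ℂ[x_1, …, x_n] → R_∞`. -/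
noncomputable def polyToHull : MvPolynomial (Fin X.n) ℂ →+* Ulim F X.ring :=
  (ulimMap F X.toRing).comp (polyHull F α X.n)

theorem polyToHull_eq_zero (f : MvPolynomial (Fin X.n) ℂ)
    (hf : MvPolynomial.aeval X.x f = 0) : X.polyToHull f = 0 := by
  obtain ⟨m, g, gp, hg, hgp, hI⟩ := X.approx_I
  have hf' : f ∈ Ideal.span (Set.range g) := by
    rw [hg]; exact hf
  have hle : Ideal.span (Set.range g) ≤ RingHom.ker X.polyToHull := by
    rw [Ideal.span_le]
    rintro _ ⟨j, rfl⟩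
    change ulimMap F X.toRing (polyHull F α X.n (g j)) = 0
    rw [← hgp, ulimMap_ulim, ← map_zero (ulim F), ulim_eq_iff]
    filter_upwards [hI] with p hp
    have : gp j p ∈ X.I p := by
      rw [hp]; exact Ideal.subset_span ⟨j, rfl⟩
    change algebraMap _ (Localization ((X.denom p).map (Ideal.Quotient.mk (X.I p))))
      (Ideal.Quotient.mk (X.I p) (gp j p)) = 0
    rw [Ideal.Quotient.eq_zero_iff_mem.2 this, map_zero]
  exact hle hf'

theorem eval_polyHull {n : ℕ} (c : Fin n → ℂ) (cp : Fin n → ∀ p, FpBar p)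
    (hc : ∀ i, ulim F (cp i) = α.symm (c i)) (f : MvPolynomial (Fin n) ℂ) :
    ulimMap F (fun p => MvPolynomial.eval (fun i => cp i p)) (polyHull F α n f) =
      α.symm (MvPolynomial.eval c f) := by
  have h : (ulimMap F (fun p => MvPolynomial.eval (fun i => cp i p))).comp (polyHull F α n) =
      α.symm.toRingHom.comp (MvPolynomial.eval c) := by
    apply MvPolynomial.ringHom_ext
    · intro z
      obtain ⟨y, hy⟩ := Ideal.Quotient.mk_surjective (α.symm z)
      simp only [RingHom.comp_apply, polyHull, MvPolynomial.coe_eval₂Hom, MvPolynomial.eval₂_C,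
        MvPolynomial.eval_C, RingEquiv.toRingHom_eq_coe, RingHom.coe_coe, ← hy, ulimMap_ulim]
    · intro i
      simp only [RingHom.comp_apply, polyHull, MvPolynomial.coe_eval₂Hom, MvPolynomial.eval₂_X,
        MvPolynomial.eval_X, RingEquiv.toRingHom_eq_coe, RingHom.coe_coe, ← hc, ulimMap_ulim]
  exact RingHom.congr_fun h f

theorem isUnit_polyToHull (s : MvPolynomial (Fin X.n) ℂ)
    (hs : IsUnit (MvPolynomial.aeval X.x s)) : IsUnit (X.polyToHull s) := by
  obtain ⟨m, g, gp, hg, hgp, hP⟩ := X.approx_P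
  set P := (IsLocalRing.maximalIdeal R).comap (MvPolynomial.aeval (R := ℂ) X.x) with hPdef
  have hsP : s ∉ P := fun h => (IsLocalRing.mem_maximalIdeal _).1 h hs
  have : P.IsPrime := Ideal.IsPrime.comap _
  rw [← MvPolynomial.IsPrime.vanishingIdeal_zeroLocus (K := ℂ) P,
    MvPolynomial.mem_vanishingIdeal_iff] at hsP
  push Not at hsP
  obtain ⟨c, hcP, hcs⟩ := hsP
  choose cp hcp using fun i => Ideal.Quotient.mk_surjective (α.symm (c i))
  obtain ⟨sp, hsp⟩ := Ideal.Quotient.mk_surjective (polyHull F α X.n s)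
  have key := eval_polyHull c cp hcp
  have h1 : ∀ᶠ p in (F : Filter Nat.Primes), MvPolynomial.eval (fun i => cp i p) (sp p) ≠ 0 := by
    rw [Ultrafilter.eventually_not]
    intro h
    have h2 := key s
    rw [← hsp, ulimMap_ulim, (ulim_eq_iff F (y := 0)).2 h, map_zero] at h2
    apply hcs
    rw [MvPolynomial.aeval_eq_eval]
    exact (map_eq_zero_iff α.symm α.symm.injective).1 h2.symm
  have h3 : ∀ᶠ p in (F : Filter Nat.Primes), ∀ j,
      MvPolynomial.eval (fun i => cp i p) (gp j p) = 0 := by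
    rw [eventually_all]
    intro j
    have h2 := key (g j)
    have hgP : g j ∈ P := by
      rw [← hg]; exact Ideal.subset_span ⟨j, rfl⟩
    have h4 := (MvPolynomial.mem_zeroLocus_iff).1 hcP _ hgP
    rw [MvPolynomial.aeval_eq_eval] at h4
    change MvPolynomial.eval c (g j) = 0 at h4
    rw [h4, map_zero, ← hgp, ulimMap_ulim, ← map_zero (ulim F), ulim_eq_iff] at h2
    exact h2
  have h5 : ∀ᶠ p in (F : Filter Nat.Primes), IsUnit (X.toRing p (sp p)) := by
    filter_upwards [h1, h3, hP] with p hp1 hp3 hpP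
    have hmem : sp p ∉ X.P p := by
      intro h
      rw [hpP] at h
      have hle : Ideal.span (Set.range fun j => gp j p) ≤
          RingHom.ker (MvPolynomial.eval (fun i => cp i p)) := by
        rw [Ideal.span_le]
        rintro _ ⟨j, rfl⟩
        exact hp3 j
      exact hp1 (hle h)
    have hden : sp p ∈ X.denom p := Submonoid.subset_closure hmem
    exact IsLocalization.map_units (Localization ((X.denom p).map (Ideal.Quotient.mk (X.I p))))
      ⟨_, Submonoid.mem_map_of_mem (Ideal.Quotient.mk (X.I p)) hden⟩
  change IsUnit (ulimMap F X.toRing (polyHull F α X.n s))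
  rw [← hsp, ulimMap_ulim]
  classical
  refine IsUnit.of_mul_eq_one (ulim F fun p => Ring.inverse (X.toRing p (sp p))) ?_
  rw [← map_mul, ← map_one (ulim F), ulim_eq_iff]
  filter_upwards [h5] with p hp
  exact Ring.mul_inverse_cancel _ hp

/-- The elements of `ℂ[x_1, …, x_n]` that become invertible in `R`, i.e. the complement of `P`. -/
noncomputable def units : Submonoid (MvPolynomial (Fin X.n) ℂ) :=
  (IsUnit.submonoid R).comap (MvPolynomial.aeval (R := ℂ) X.x)

theorem isUnit_of_units (y : X.units) :
    IsUnit ((MvPolynomial.aeval (R := ℂ) X.x).toRingHom y) := y.2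

/-- The canonical homomorphism from the localization of `ℂ[x_1, …, x_n]` at `P` to `R`. -/
noncomputable def locToRing : Localization X.units →+* R :=
  IsLocalization.lift X.isUnit_of_units

/-- The canonical homomorphism from the localization of `ℂ[x_1, …, x_n]` at `P` to `R_∞`. -/
noncomputable def locToHull : Localization X.units →+* Ulim F X.ring :=
  IsLocalization.lift (M := X.units) (g := X.polyToHull) fun y => X.isUnit_polyToHull _ y.2

theorem locToRing_surjective : Function.Surjective X.locToRing := by
  intro r
  obtain ⟨f, s, hs, h⟩ := X.frac r
  refine ⟨IsLocalization.mk' _ f (⟨s, hs⟩ : X.units), ?_⟩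
  rw [locToRing, IsLocalization.lift_mk'_spec, mul_comm]
  exact h.symm

theorem locToRing_ker_le : RingHom.ker X.locToRing ≤ RingHom.ker X.locToHull := by
  intro z hz
  obtain ⟨f, s, rfl⟩ := IsLocalization.exists_mk'_eq X.units z
  rw [RingHom.mem_ker, locToRing, IsLocalization.lift_mk'_spec, mul_zero] at hz
  rw [RingHom.mem_ker, locToHull, IsLocalization.lift_mk'_spec, mul_zero]
  exact X.polyToHull_eq_zero f hz

/-- The canonical homomorphism from `R` to its non-standard hull `R_∞ = ulim R_p`. By
`toHull_aeval`, it is the one compatible with the homomorphism from `ℂ[x_1, …, x_n]`. -/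
noncomputable def toHull : R →+* Ulim F X.ring :=
  RingHom.liftOfRightInverse X.locToRing (Function.surjInv X.locToRing_surjective)
    (Function.rightInverse_surjInv X.locToRing_surjective) ⟨X.locToHull, X.locToRing_ker_le⟩

theorem toHull_aeval (f : MvPolynomial (Fin X.n) ℂ) :
    X.toHull (MvPolynomial.aeval X.x f) = X.polyToHull f := by
  have h := RingHom.liftOfRightInverse_comp_apply X.locToRing
    (Function.surjInv X.locToRing_surjective)
    (Function.rightInverse_surjInv X.locToRing_surjective) ⟨X.locToHull, X.locToRing_ker_le⟩
    (algebraMap _ _ f)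
  simpa [toHull, locToRing, locToHull] using h

/-- The ultra-Frobenius `F^ε : R → R_∞`. -/
noncomputable def frob (ε : HyperNat F) : R →+* Ulim F X.ring :=
  (ultraFrob ε).comp X.toHull

/-- `(R, 𝔞^t)` is sharply ultra-`F`-pure, where the family `𝔞_p` is an approximation of `𝔞`:
for all `ε₀` there are `ε ≥ ε₀` and `f` in the internal power `𝔞 ^ ⌈t (π ^ ε - 1)⌉` such that
`f F^ε : R → R_∞` is pure. -/
def IsSharplyUltraFPure (a : ∀ p, Ideal (X.ring p)) (t : ℝ) : Prop :=
  ∀ ε₀ : HyperNat F, ∃ ε : HyperNat F, ε₀ ≤ ε ∧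
    ∃ f ∈ idealHyperPow a (hyperExponent F t ε), IsPureTwist (X.frob ε) f

/-- The family of maps `φ_p : R_p → S_p` is an approximation of `φ : R → S`: for almost all `p`,
`φ_p` is a homomorphism of algebras over `FpBar p`, and the `φ_p` take approximations of any
`r` in `R` to approximations of `φ r`. -/
def IsHomApprox {S : Type v} [CommRing S] [IsLocalRing S] [Algebra ℂ S]
    (Y : LocalApprox F α S) (φ : R →+* S) (φp : ∀ p, X.ring p → Y.ring p) : Prop :=
  (∀ᶠ p in (F : Filter Nat.Primes), ∃ ψ : X.ring p →ₐ[FpBar p] Y.ring p, φp p = ψ) ∧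
    ∀ (r : R) (rp : ∀ p, X.ring p), ulim F rp = X.toHull r →
      ulim F (fun p => φp p (rp p)) = Y.toHull (φ r)

end LocalApprox

end Approximation

/-! Purity is equational: by `isPureTwist_iff`, `x ↦ c * φ x` is pure exactly when a finite linear
system over `A` is solvable as soon as its image under `φ`, with right-hand side multiplied by `c`,
is solvable in `B`. Such a condition passes through ultraproducts. If a system over `R`, twisted by
`f F^ε`, has a solution in `R_∞`, then for almost all `p` there is a twisted solution over `R_p`,
hence over `S_p`. There purity of `x ↦ f_p x ^ (p ^ e_p)` removes the twist, and the resulting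
solutions form one over `S_∞`. Purity of `S → S_∞` and of `R → S` brings it down to `R`
(`isPureTwist_frob_of_eventually`). Purity of `R_p → S_p` plays no role, and part 1 is the case `S =
R`.

The twist can be taken to be a monomial because over a local ring the elements with impure twist
form an ideal (`impureIdeal`): witnesses against `b` and `c` are glued along socle elements to a
witness against `b + c`. If all monomials of degree `N` in the generators were impure, so would be
the whole `N`-th power of the ideal.

What remains is that the `S_p` are almost always local and that `R → R_∞` is pure
(`isPureRingHom_toHull`). Both rest on two facts about the hull of `ℂ[x_1, …, x_n]`. It is flat
(`polyHull_flat`), by induction on `n`: Nagata's change of variables makes a coefficient of a given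
equation monic in one variable, division by it reduces solutions to bounded degree in that variable,
and those live in a polynomial ring over the hull in fewer variables. Approximations of a prime `P`
are almost always prime (`eventually_isPrime`): `P` defines a variety birational to a hypersurface
`h = 0`, irreducibility of `h` passes to its approximations by degree bounds, and flatness keeps the
denominator `s` a nonzerodivisor modulo `P_p`, so that `P_p` is the kernel of a map to a field. A
solution over `R_∞` then becomes a relation over the hull whose denominator lies outside `P`;
flatness produces a relation over `ℂ[x_1, …, x_n]` with the same property, which is a solution in
`R`. -/

/-! ## Purity of twisted ring homomorphisms -/

/-- Membership form of purity: no nonzero `z ∈ M` is killed by `z ↦ z ⊗ c`. -/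
theorem isPureTwist_iff_tmul {A : Type u} {B : Type v} [CommRing A] [CommRing B] [Algebra A B]
    (c : B) : IsPureTwist (algebraMap A B) c ↔
      ∀ (M : Type u) [AddCommGroup M] [Module A M] (z : M), z ⊗ₜ[A] c = 0 → z = 0 := by
  have hmod : Module.compHom B (algebraMap A B) = (Algebra.toModule : Module A B) := by
    ext a b
    exact (Algebra.smul_def a b).symm
  generalize hP : (∀ (M : Type u) [AddCommGroup M] [Module A M] (z : M), z ⊗ₜ[A] c = 0 → z = 0) = P
  -- The two module structures on `B` agree only propositionally. Quantifying over the instance lets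
  -- the equality be eliminated, while `P` shields the side that already uses the algebra structure.
  suffices key : ∀ inst : Module A B, inst = Algebra.toModule →
      ((∀ (M : Type u) [AddCommGroup M] [Module A M],
        Function.Injective (LinearMap.lTensor M (LinearMap.toSpanSingleton A B c))) ↔ P) from
    key _ hmod
  subst hP
  rintro _ rfl
  refine forall₃_congr fun M _ _ => ?_
  rw [injective_iff_map_eq_zero]
  constructor
  · intro h z hz
    have := h (z ⊗ₜ 1) (by simpa using hz)
    simpa using congrArg (TensorProduct.rid A M) this
  · intro h x hx
    obtain ⟨z, rfl⟩ := (TensorProduct.rid A M).symm.surjective x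
    simp only [TensorProduct.rid_symm_apply, LinearMap.lTensor_tmul,
      LinearMap.toSpanSingleton_apply, one_smul] at hx
    rw [h z hx]
    simp

/-- If `m` is killed in `M ⊗ N` by `n`, this is witnessed by finitely many relations in `M`. -/
theorem exists_relations_of_tmul_eq_zero {A : Type u} [CommRing A] {M N : Type*} [AddCommGroup M]
    [Module A M] [AddCommGroup N] [Module A N] {z : M} {n : N} (h : z ⊗ₜ[A] n = 0) :
    ∃ (m k : ℕ) (e : Fin (m + 1) → M) (a : Fin (m + 1) → Fin k → A) (y : Fin k → N),
      e 0 = z ∧ n = ∑ j, a 0 j • y j ∧ (∀ i : Fin m, ∑ j, a i.succ j • y j = 0) ∧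
        ∀ j, ∑ i, a i j • e i = 0 := by
  -- The criterion for the vanishing of a sum of tensors needs a generating family. The tensor
  -- already vanishes over a finitely generated submodule `P`, and `z` followed by generators of
  -- `P`, paired with `n, 0, …, 0`, is such a family.
  obtain ⟨P, hP, hle, hPe⟩ := Submodule.FG.exists_rTensor_fg_inclusion_eq (M := N)
    (N := Submodule.span A {z}) (Submodule.fg_span_singleton z)
    (x := (⟨z, Submodule.mem_span_singleton_self z⟩ : Submodule.span A {z}) ⊗ₜ[A] n) (y := 0)
    (by simpa using h)
  have hz : z ∈ P := hle (Submodule.mem_span_singleton_self z)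
  have h0 : (⟨z, hz⟩ : P) ⊗ₜ[A] n = 0 := by
    rw [LinearMap.rTensor_tmul, map_zero] at hPe
    exact hPe
  have : Module.Finite A P := Module.Finite.iff_fg.2 hP
  obtain ⟨m, s, hs⟩ := Module.Finite.exists_fin (R := A) (M := P)
  have hv := TensorProduct.vanishesTrivially_of_sum_tmul_eq_zero (R := A)
    (m := (Fin.cons ⟨z, hz⟩ s : Fin (m + 1) → P)) (n := (Fin.cons n 0 : Fin (m + 1) → N))
    (by
      rw [eq_top_iff, ← hs]
      exact Submodule.span_mono (by rw [Fin.range_cons]; exact Set.subset_insert _ _))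
    (by simp [Fin.sum_univ_succ, h0])
  obtain ⟨k, a, y, h1, h2⟩ := hv
  refine ⟨m, k, fun i => ((Fin.cons ⟨z, hz⟩ s : Fin (m + 1) → P) i : M), a, y, rfl,
    by simpa using h1 0, fun i => ?_, fun j => ?_⟩
  · simpa using (h1 i.succ).symm
  · simpa using congrArg P.subtype (h2 j)

/-- Purity in terms of systems of linear equations. -/
theorem isPureTwist_iff {A : Type u} {B : Type v} [CommRing A] [CommRing B] (φ : A →+* B)
    (c : B) : IsPureTwist φ c ↔
      ∀ (m k : ℕ) (a : Fin m → Fin k → A) (x : Fin m → A) (w : Fin k → B),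
        (∀ i, φ (x i) * c = ∑ j, φ (a i j) * w j) →
          ∃ y : Fin k → A, ∀ i, x i = ∑ j, a i j * y j := by
  let _ : Algebra A B := φ.toAlgebra
  change IsPureTwist (algebraMap A B) c ↔ _
  rw [isPureTwist_iff_tmul]
  constructor
  · intro h m k a x w hw
    -- The test module is the cokernel of the matrix `a`: the class of `x` vanishes there iff the
    -- system is solvable in `A`, and `w` shows that it is killed by `⊗ c`.
    set N : Submodule A (Fin m → A) := Submodule.span A (Set.range fun j i => a i j)
    have key : (N.mkQ x) ⊗ₜ[A] c = 0 := by
      have hx : x = ∑ i, x i • Pi.single i (1 : A) := by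
        ext l; simp [Finset.sum_apply, Pi.single_apply]
      have e1 : (N.mkQ x) ⊗ₜ[A] c = ∑ i, ∑ j, N.mkQ (a i j • Pi.single i (1 : A)) ⊗ₜ[A] w j := by
        conv_lhs => rw [hx]
        simp only [map_sum, map_smul, TensorProduct.sum_tmul, ← TensorProduct.smul_tmul']
        refine Finset.sum_congr rfl fun i _ => ?_
        rw [← TensorProduct.tmul_smul, Algebra.smul_def,
          show algebraMap A B (x i) * c = ∑ j, a i j • w j by
            simp only [Algebra.smul_def]; exact hw i, TensorProduct.tmul_sum]
        simp
      rw [e1, Finset.sum_comm]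
      refine Finset.sum_eq_zero fun j _ => ?_
      rw [← TensorProduct.sum_tmul, ← map_sum]
      have : ∑ i, a i j • Pi.single i (1 : A) = fun i => a i j := by
        ext l; simp [Finset.sum_apply, Pi.single_apply]
      have h0 : N.mkQ (fun i => a i j) = 0 :=
        (Submodule.Quotient.mk_eq_zero N).2 (Submodule.subset_span ⟨j, rfl⟩)
      rw [this, h0, TensorProduct.zero_tmul]
    have hx := (Submodule.Quotient.mk_eq_zero N).1 (h _ _ key)
    obtain ⟨y, hy⟩ := (Submodule.mem_span_range_iff_exists_fun A).1 hx
    refine ⟨y, fun i => ?_⟩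
    rw [← hy]
    simp [Finset.sum_apply, mul_comm]
  · intro h M _ _ z hz
    obtain ⟨m, k, e, a, w, rfl, h1, h2, h3⟩ := exists_relations_of_tmul_eq_zero hz
    -- The relations say that `w` solves the twisted system whose right-hand side is the first unit
    -- vector. An untwisted solution writes `e 0` as a combination of the vanishing sums in `h3`.
    obtain ⟨y, hy⟩ := h (m + 1) k a (Pi.single 0 1) w (fun i => by
      simp only [Algebra.smul_def] at h1 h2
      change algebraMap A B _ * c = ∑ j, algebraMap A B _ * w j
      cases i using Fin.cases with
      | zero => simpa using h1
      | succ i => simpa using (h2 i).symm)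
    calc e 0 = ∑ i, (Pi.single 0 1 : Fin (m + 1) → A) i • e i := by simp [Pi.single_apply]
      _ = ∑ i, ∑ j, y j • a i j • e i := by
        refine Finset.sum_congr rfl fun i _ => ?_
        rw [hy, Finset.sum_smul]
        exact Finset.sum_congr rfl fun j _ => by rw [mul_comm, mul_smul]
      _ = 0 := by
        rw [Finset.sum_comm]
        refine Finset.sum_eq_zero fun j _ => ?_
        rw [← Finset.smul_sum, h3, smul_zero]

/-- A solution `w` of a system twisted by `c` gives the solution `b * w` of the system twisted by `b
* c`. Hence impurity is inherited by multiples. -/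
theorem IsPureTwist.of_mul {A : Type u} {B : Type v} [CommRing A] [CommRing B] {φ : A →+* B}
    {b c : B} (h : IsPureTwist φ (b * c)) : IsPureTwist φ c := by
  rw [isPureTwist_iff] at h ⊢
  intro m k a x w hw
  refine h m k a x (fun j => b * w j) fun i => ?_
  rw [mul_left_comm, hw, Finset.mul_sum]
  simp only [mul_left_comm]

/-! ### Impure elements over a local ring -/

/-- Over a local ring, impurity is witnessed by a nonzero socle element. -/
theorem exists_socle_of_not_isPureTwist {A : Type u} {B : Type v} [CommRing A] [IsLocalRing A]
    [CommRing B] [Algebra A B] {c : B} (h : ¬ IsPureTwist (algebraMap A B) c) :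
    ∃ (M : Type u) (_ : AddCommGroup M) (_ : Module A M) (z : M), z ≠ 0 ∧ z ⊗ₜ[A] c = 0 ∧
      ∀ r ∈ IsLocalRing.maximalIdeal A, r • z = 0 := by
  rw [isPureTwist_iff_tmul] at h
  push Not at h
  obtain ⟨M, _, _, z, hz, hz0⟩ := h
  -- Dividing by `𝔪 z` makes the class of `z` a socle element. It stays nonzero, for `z = r z` with
  -- `r ∈ 𝔪` would force `z = 0`, as `1 - r` is a unit.
  let K : Submodule A M :=
    Submodule.map (LinearMap.toSpanSingleton A M z) (IsLocalRing.maximalIdeal A)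
  refine ⟨M ⧸ K, inferInstance, inferInstance, K.mkQ z, fun h0 => ?_, ?_, fun r hr => ?_⟩
  · obtain ⟨r, hr, hrz⟩ := (Submodule.Quotient.mk_eq_zero K).1 h0
    have hu : IsUnit (1 - r) := by
      by_contra hu
      have := Ideal.add_mem _ ((IsLocalRing.mem_maximalIdeal _).2 hu) hr
      rw [sub_add_cancel] at this
      exact (IsLocalRing.mem_maximalIdeal _).1 this isUnit_one
    apply hz0
    refine hu.smul_left_cancel.1 ?_
    rw [smul_zero, sub_smul, one_smul, sub_eq_zero]
    exact hrz.symm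
  · simpa using congrArg (LinearMap.rTensor B K.mkQ) hz
  · rw [← map_smul]
    exact (Submodule.Quotient.mk_eq_zero K).2 ⟨r, hr, rfl⟩

/-- Let socle elements `z` of `M` and `y` of `N` be killed by `⊗ b` and `⊗ c`. In `M × N` modulo
`(z, -y)` their common class is killed by both, hence by `⊗ (b + c)`. It is nonzero: `r (z, -y) =
(z, 0)` gives `r y = 0`, so `r ∈ 𝔪` and `z = r z = 0`. -/
theorem not_isPureTwist_add {A : Type u} {B : Type v} [CommRing A] [IsLocalRing A]
    [CommRing B] {φ : A →+* B} {b c : B} (hb : ¬ IsPureTwist φ b) (hc : ¬ IsPureTwist φ c) :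
    ¬ IsPureTwist φ (b + c) := by
  let _ : Algebra A B := φ.toAlgebra
  change ¬ IsPureTwist (algebraMap A B) (b + c)
  obtain ⟨M, _, _, z, hz0, hz, hzm⟩ := exists_socle_of_not_isPureTwist (A := A) hb
  obtain ⟨N, _, _, y, hy0, hy, hym⟩ := exists_socle_of_not_isPureTwist (A := A) hc
  intro h
  rw [isPureTwist_iff_tmul] at h
  let K : Submodule A (M × N) := Submodule.span A {(z, -y)}
  have hzy : K.mkQ (z, 0) = K.mkQ (0, y) := by
    rw [← sub_eq_zero, ← map_sub]
    refine (Submodule.Quotient.mk_eq_zero K).2 ?_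
    rw [show ((z, 0) - (0, y) : M × N) = (z, -y) by simp]
    exact Submodule.mem_span_singleton_self (R := A) (z, -y)
  have hzb : K.mkQ (z, 0) ⊗ₜ[A] b = 0 := by
    simpa using congrArg (LinearMap.rTensor B (K.mkQ ∘ₗ LinearMap.inl A M N)) hz
  have hzc : K.mkQ (z, 0) ⊗ₜ[A] c = 0 := by
    rw [hzy]
    simpa using congrArg (LinearMap.rTensor B (K.mkQ ∘ₗ LinearMap.inr A M N)) hy
  have h0 := h _ (K.mkQ (z, 0)) (by rw [TensorProduct.tmul_add, hzb, hzc, add_zero])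
  obtain ⟨r, hr⟩ := Submodule.mem_span_singleton.1 ((Submodule.Quotient.mk_eq_zero K).1 h0)
  obtain ⟨h1, h2⟩ := Prod.ext_iff.1 hr
  simp only [Prod.smul_mk, smul_neg, neg_eq_zero] at h1 h2
  have hrm : r ∈ IsLocalRing.maximalIdeal A := by
    rw [IsLocalRing.mem_maximalIdeal, mem_nonunits_iff]
    intro hu
    exact hy0 (hu.smul_left_cancel.1 (h2.trans (smul_zero r).symm))
  exact hz0 (h1 ▸ hzm r hrm)

theorem not_isPureTwist_zero {A : Type u} {B : Type v} [CommRing A] [Nontrivial A]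
    [CommRing B] (φ : A →+* B) : ¬ IsPureTwist φ 0 := by
  rw [isPureTwist_iff]
  intro h
  obtain ⟨y, hy⟩ := h 1 0 0 1 0 (by simp)
  simpa using hy 0

/-- Over a local ring, the elements `c` for which `x ↦ c * φ x` is not pure form an ideal. -/
def impureIdeal {A : Type u} {B : Type v} [CommRing A] [IsLocalRing A] [CommRing B]
    (φ : A →+* B) : Ideal B where
  carrier := {c | ¬ IsPureTwist φ c}
  zero_mem' := not_isPureTwist_zero φ
  add_mem' := not_isPureTwist_add
  smul_mem' _ _ hc h := hc h.of_mul

theorem span_range_pow_le {A : Type*} [CommRing A] {n : ℕ} (f : Fin n → A) (N : ℕ) :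
    Ideal.span (Set.range f) ^ N ≤
      Ideal.span {g | ∃ μ : Fin n → ℕ, ∑ i, μ i = N ∧ g = ∏ i, f i ^ μ i} := by
  induction N with
  | zero =>
    rw [pow_zero, Ideal.one_eq_top, top_le_iff, Ideal.eq_top_iff_one]
    exact Ideal.subset_span ⟨0, by simp, by simp⟩
  | succ N ih =>
    rw [pow_succ]
    refine (Ideal.mul_mono_left ih).trans ?_
    rw [Ideal.span_mul_span', Ideal.span_le]
    rintro _ ⟨_, ⟨μ, hμ, rfl⟩, _, ⟨i, rfl⟩, rfl⟩
    refine Ideal.subset_span ⟨μ + Pi.single i 1, ?_, ?_⟩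
    · simp [Finset.sum_add_distrib, hμ]
    · simp only [Pi.add_apply, pow_add, Finset.prod_mul_distrib]
      congr 1
      simp [Pi.single_apply, pow_ite]

/-- Over a local ring, if some element of the `N`-th power of `(f_1, …, f_n)` gives a pure map
then so does some monomial of degree `N` in the `f_i`. -/
theorem IsPureTwist.exists_monomial {A : Type u} {B : Type v} [CommRing A] [IsLocalRing A]
    [CommRing B] {φ : A →+* B} {n : ℕ} {f : Fin n → B} {N : ℕ} {c : B}
    (hc : c ∈ Ideal.span (Set.range f) ^ N) (h : IsPureTwist φ c) :
    ∃ μ : Fin n → ℕ, ∑ i, μ i = N ∧ IsPureTwist φ (∏ i, f i ^ μ i) := by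
  by_contra! hne
  have hle : Ideal.span {g | ∃ μ : Fin n → ℕ, ∑ i, μ i = N ∧ g = ∏ i, f i ^ μ i} ≤
      impureIdeal φ := by
    rw [Ideal.span_le]
    rintro _ ⟨μ, hμ, rfl⟩
    exact hne μ hμ
  exact hle (span_range_pow_le f N hc) h

/-! ## The non-standard hull of a polynomial ring -/

theorem exists_ulim_eq (F : Ultrafilter Nat.Primes) {A : Nat.Primes → Type u}
    [∀ p, CommRing (A p)] {ι : Type*} (w : ι → Ulim F A) :
    ∃ x : ι → ∀ p, A p, ∀ i, ulim F (x i) = w i := by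
  choose x hx using fun i => Ideal.Quotient.mk_surjective (I := ultraIdeal F A) (w i)
  exact ⟨x, hx⟩

theorem ulim_eq_zero_iff (F : Ultrafilter Nat.Primes) {A : Nat.Primes → Type u}
    [∀ p, CommRing (A p)] {x : ∀ p, A p} :
    ulim F x = 0 ↔ ∀ᶠ p in (F : Filter Nat.Primes), x p = 0 := by
  rw [← map_zero (ulim F), ulim_eq_iff]
  rfl

section PolyHull

variable {F : Ultrafilter Nat.Primes} {α : Ulim F FpBar ≃+* ℂ} {n : ℕ}

theorem polyHull_C (c : ∀ p, FpBar p) :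
    polyHull F α n (MvPolynomial.C (α (ulim F c))) = ulim F fun p => MvPolynomial.C (c p) := by
  simp [polyHull, ulimMap_ulim]

theorem polyHull_X (i : Fin n) :
    polyHull F α n (MvPolynomial.X i) = ulim F fun _ => MvPolynomial.X i := by
  simp [polyHull]

theorem polyHull_sum_monomial (S : Finset (Fin n →₀ ℕ)) (c : (Fin n →₀ ℕ) → ∀ p, FpBar p) :
    polyHull F α n (∑ m ∈ S, MvPolynomial.monomial m (α (ulim F (c m)))) =
      ulim F fun p => ∑ m ∈ S, MvPolynomial.monomial m (c m p) := by
  have h : (fun p => ∑ m ∈ S, MvPolynomial.monomial m (c m p)) =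
      ∑ m ∈ S, (fun p => (MvPolynomial.C (c m p) : MvPolynomial (Fin n) (FpBar p))) *
        ∏ i, (fun _ => MvPolynomial.X i) ^ m i := by
    ext1 p
    simp [Finset.sum_apply, Finset.prod_apply, MvPolynomial.monomial_eq, Finsupp.prod_fintype]
  rw [h, map_sum, map_sum]
  refine Finset.sum_congr rfl fun m _ => ?_
  rw [MvPolynomial.monomial_eq, Finsupp.prod_fintype _ _ (fun _ => pow_zero _)]
  simp only [map_mul, map_prod, map_pow, polyHull_C, polyHull_X]

/-- Every polynomial has an approximation with the same support. -/
theorem exists_approx (f : MvPolynomial (Fin n) ℂ) :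
    ∃ c : (Fin n →₀ ℕ) → ∀ p, FpBar p, (∀ m, α (ulim F (c m)) = f.coeff m) ∧
      polyHull F α n f = ulim F fun p => ∑ m ∈ f.support, MvPolynomial.monomial m (c m p) := by
  obtain ⟨c, hc⟩ := exists_ulim_eq F fun m => α.symm (f.coeff m)
  have hc' : ∀ m, α (ulim F (c m)) = f.coeff m := fun m => by rw [hc, RingEquiv.apply_symm_apply]
  refine ⟨c, hc', ?_⟩
  rw [← polyHull_sum_monomial (α := α)]
  simp only [hc', MvPolynomial.support_sum_monomial_coeff]

theorem polyHull_injective : Function.Injective (polyHull F α n) := by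
  rw [injective_iff_map_eq_zero]
  intro f hf
  obtain ⟨c, hc, hfc⟩ := exists_approx (F := F) (α := α) f
  rw [hfc, ulim_eq_zero_iff] at hf
  ext m
  by_cases hm : m ∈ f.support
  · rw [← hc, MvPolynomial.coeff_zero, map_eq_zero_iff α α.injective, ulim_eq_zero_iff]
    filter_upwards [hf] with p hp
    have := congrArg (MvPolynomial.coeff m) hp
    simpa [MvPolynomial.coeff_sum, MvPolynomial.coeff_monomial, hm] using this
  · simpa using hm

/-- Combined with the converse `exists_polyHull_eq_of_totalDegree_le`, this allows factors found in
characteristic `p` to be lifted to `ℂ`: their degrees are bounded by that of the product. -/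
theorem eventually_totalDegree_le {f : MvPolynomial (Fin n) ℂ}
    {fp : ∀ p, MvPolynomial (Fin n) (FpBar p)} (h : ulim F fp = polyHull F α n f) :
    ∀ᶠ p in (F : Filter Nat.Primes), (fp p).totalDegree ≤ f.totalDegree := by
  obtain ⟨c, -, hfc⟩ := exists_approx (F := F) (α := α) f
  rw [hfc, ulim_eq_iff] at h
  filter_upwards [h] with p hp
  rw [hp]
  refine MvPolynomial.totalDegree_finsetSum_le fun m hm => ?_
  exact (MvPolynomial.totalDegree_monomial_le _ _).trans (MvPolynomial.le_totalDegree hm)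

/-- A sequence of polynomials of bounded degree is an approximation of a polynomial. -/
theorem exists_polyHull_eq_of_totalDegree_le {fp : ∀ p, MvPolynomial (Fin n) (FpBar p)} (D : ℕ)
    (h : ∀ᶠ p in (F : Filter Nat.Primes), (fp p).totalDegree ≤ D) :
    ∃ f, polyHull F α n f = ulim F fp := by
  -- All exponents of total degree at most `D`: one finite set that serves every `p`.
  let S : Finset (Fin n →₀ ℕ) := (Finset.range (D + 1)).biUnion fun k =>
    Finset.finsuppAntidiag Finset.univ k
  refine ⟨_, (polyHull_sum_monomial S fun m p => (fp p).coeff m).trans ?_⟩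
  rw [ulim_eq_iff]
  filter_upwards [h] with p hp
  conv_rhs => rw [← MvPolynomial.support_sum_monomial_coeff (fp p)]
  refine (Finset.sum_subset (fun m hm => ?_) fun m _ hm => ?_).symm
  · have := MvPolynomial.le_totalDegree hm
    simp only [S, Finset.mem_biUnion, Finset.mem_range, Finset.mem_finsuppAntidiag]
    refine ⟨_, Nat.lt_succ_of_le (this.trans hp), ?_, Finset.subset_univ _⟩
    rw [Finsupp.sum_fintype _ _ (fun _ => rfl)]
  · rw [MvPolynomial.notMem_support_iff.1 hm, map_zero]

theorem eventually_ne_zero {f : MvPolynomial (Fin n) ℂ} (hf : f ≠ 0)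
    {fp : ∀ p, MvPolynomial (Fin n) (FpBar p)} (h : ulim F fp = polyHull F α n f) :
    ∀ᶠ p in (F : Filter Nat.Primes), fp p ≠ 0 := by
  rw [Ultrafilter.eventually_not, ← ulim_eq_zero_iff, h]
  exact fun h0 => hf (polyHull_injective (h0.trans (map_zero _).symm))

/-- Approximations of an irreducible polynomial are almost always irreducible. -/
theorem eventually_irreducible {f : MvPolynomial (Fin n) ℂ} (hf : Irreducible f)
    {fp : ∀ p, MvPolynomial (Fin n) (FpBar p)} (h : ulim F fp = polyHull F α n f) :
    ∀ᶠ p in (F : Filter Nat.Primes), Irreducible (fp p) := by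
  by_contra hcon
  rw [← Ultrafilter.eventually_not] at hcon
  have hne := eventually_ne_zero hf.ne_zero h
  have hdeg := eventually_totalDegree_le h
  have hnu : ∀ᶠ p in (F : Filter Nat.Primes), ¬ IsUnit (fp p) := by
    rw [Ultrafilter.eventually_not]
    intro hu
    -- If the `fp p` were units they would be constants, so `f` would be a nonzero constant.
    have h0 : ∀ᶠ p in (F : Filter Nat.Primes), fp p = MvPolynomial.C ((fp p).coeff 0) := by
      filter_upwards [hu] with p hp
      exact MvPolynomial.totalDegree_eq_zero_iff_eq_C.1
        (MvPolynomial.isUnit_iff_totalDegree_of_isReduced.1 hp).2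
    rw [← ulim_eq_iff, ← polyHull_C (α := α), h] at h0
    have h1 := polyHull_injective h0
    refine hf.not_isUnit ?_
    rw [h1]
    refine (isUnit_iff_ne_zero.2 fun h2 => ?_).map MvPolynomial.C
    rw [h2, map_zero] at h1
    exact hf.ne_zero h1
  have hex : ∀ p, ∃ a b : MvPolynomial (Fin n) (FpBar p), fp p ≠ 0 → ¬ IsUnit (fp p) →
      ¬ Irreducible (fp p) → fp p = a * b ∧ ¬ IsUnit a ∧ ¬ IsUnit b := by
    intro p
    by_cases hp : Irreducible (fp p) ∨ IsUnit (fp p)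
    · exact ⟨0, 0, fun _ h1 h2 => absurd hp (by tauto)⟩
    · rw [irreducible_iff] at hp
      push Not at hp
      obtain ⟨a, b, h1, h2, h3⟩ := hp.1 hp.2
      exact ⟨a, b, fun _ _ _ => ⟨h1, h2, h3⟩⟩
  choose a b hab using hex
  have hab' : ∀ᶠ p in (F : Filter Nat.Primes), fp p = a p * b p ∧ ¬ IsUnit (a p) ∧
      ¬ IsUnit (b p) ∧ fp p ≠ 0 := by
    filter_upwards [hne, hnu, hcon] with p h1 h2 h3
    exact ⟨(hab p h1 h2 h3).1, (hab p h1 h2 h3).2.1, (hab p h1 h2 h3).2.2, h1⟩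
  have hda : ∀ᶠ p in (F : Filter Nat.Primes), (a p).totalDegree ≤ f.totalDegree := by
    filter_upwards [hab', hdeg] with p ⟨h1, _, _, h2⟩ h3
    rw [h1] at h2 h3
    rw [MvPolynomial.totalDegree_mul_of_isDomain (left_ne_zero_of_mul h2)
      (right_ne_zero_of_mul h2)] at h3
    omega
  have hdb : ∀ᶠ p in (F : Filter Nat.Primes), (b p).totalDegree ≤ f.totalDegree := by
    filter_upwards [hab', hdeg] with p ⟨h1, _, _, h2⟩ h3
    rw [h1] at h2 h3
    rw [MvPolynomial.totalDegree_mul_of_isDomain (left_ne_zero_of_mul h2)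
      (right_ne_zero_of_mul h2)] at h3
    omega
  obtain ⟨a', ha'⟩ := exists_polyHull_eq_of_totalDegree_le (α := α) _ hda
  obtain ⟨b', hb'⟩ := exists_polyHull_eq_of_totalDegree_le (α := α) _ hdb
  have hfab : f = a' * b' := by
    apply polyHull_injective (F := F) (α := α)
    rw [map_mul, ha', hb', ← h, ← map_mul, ulim_eq_iff]
    filter_upwards [hab'] with p hp using hp.1
  -- A unit over `ℂ` is a constant, so its approximations are constants; in characteristic `p` this
  -- leaves only zero and units, both excluded for the factors of `fp p`.
  have key : ∀ (g : MvPolynomial (Fin n) ℂ) (gp : ∀ p, MvPolynomial (Fin n) (FpBar p)),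
      polyHull F α n g = ulim F gp → IsUnit g →
        ∀ᶠ p in (F : Filter Nat.Primes), gp p = 0 ∨ IsUnit (gp p) := by
    intro g gp hg hu
    filter_upwards [eventually_totalDegree_le hg.symm] with p hp
    rw [(MvPolynomial.isUnit_iff_totalDegree_of_isReduced.1 hu).2, Nat.le_zero] at hp
    rw [MvPolynomial.totalDegree_eq_zero_iff_eq_C.1 hp]
    exact (eq_or_ne _ 0).imp (fun h0 => by rw [h0, map_zero])
      fun h0 => (isUnit_iff_ne_zero.2 h0).map MvPolynomial.C
  rcases hf.isUnit_or_isUnit hfab with hu | hu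
  · obtain ⟨p, h1, h2, h3, -, h4⟩ := ((key a' a ha' hu).and hab').exists
    rw [h2] at h4
    exact h1.elim (left_ne_zero_of_mul h4) h3
  · obtain ⟨p, h1, h2, -, h3, h4⟩ := ((key b' b hb' hu).and hab').exists
    rw [h2] at h4
    exact h1.elim (right_ne_zero_of_mul h4) h3

end PolyHull

/-! ## Flatness of the hull: adjoining one variable -/

/-- Flatness of a ring homomorphism in terms of solutions of linear equations. -/
theorem RingHom.flat_iff_mem_span {A : Type u} {B : Type v} [CommRing A] [CommRing B]
    (φ : A →+* B) : φ.Flat ↔ ∀ (l : ℕ) (f : Fin l → A) (x : Fin l → B), ∑ i, φ (f i) * x i = 0 →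
      x ∈ Submodule.span B {s : Fin l → B | ∃ t : Fin l → A, ∑ i, f i * t i = 0 ∧ s = φ ∘ t} := by
  let _ : Algebra A B := φ.toAlgebra
  change Module.Flat A B ↔ _
  rw [Module.Flat.iff_forall_isTrivialRelation]
  constructor
  · intro h l f x hx
    obtain ⟨k, a, y, h1, h2⟩ := h (f := f) (x := x) (by simpa only [Algebra.smul_def] using! hx)
    have : x = ∑ j, y j • (fun i => φ (a i j)) := by
      ext i
      rw [h1, Finset.sum_apply]
      refine Finset.sum_congr rfl fun j _ => ?_
      rw [Algebra.smul_def, mul_comm]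
      rfl
    rw [this]
    exact Submodule.sum_mem _ fun j _ => Submodule.smul_mem _ _
      (Submodule.subset_span ⟨fun i => a i j, h2 j, rfl⟩)
  · intro h l f x hx
    obtain ⟨k, y, g, hg⟩ := Submodule.mem_span_set'.1
      (h l f x (by simpa only [Algebra.smul_def] using! hx))
    choose t ht1 ht2 using fun j => (g j).2
    refine ⟨k, fun i j => t j i, y, fun i => ?_, fun j => ht1 j⟩
    rw [← hg, Finset.sum_apply]
    refine Finset.sum_congr rfl fun j _ => ?_
    rw [ht2, Algebra.smul_def, mul_comm]
    rfl

/-- `S[X]` is the base change of `S` along `R → R[X]`. -/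
theorem Polynomial.flat_mapRingHom {R S : Type u} [CommRing R] [CommRing S] {φ : R →+* S}
    (h : φ.Flat) : (Polynomial.mapRingHom φ).Flat := by
  let _ : Algebra R S := φ.toAlgebra
  let _ : Algebra (Polynomial R) (Polynomial S) := Polynomial.algebra R S
  exact RingHom.Flat.isStableUnderBaseChange R S (Polynomial R) (Polynomial S) h

section PolynomialHull

variable (F : Ultrafilter Nat.Primes) (A : Nat.Primes → Type u) [∀ p, CommRing (A p)]

/-- The canonical homomorphism from the polynomial ring over an ultraproduct to the ultraproduct
of the polynomial rings. -/
noncomputable def polynomialUlim :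
    Polynomial (Ulim F A) →+* Ulim F fun p => Polynomial (A p) :=
  Polynomial.eval₂RingHom (ulimMap F fun p => (Polynomial.C : A p →+* Polynomial (A p)))
    (ulim F fun _ => Polynomial.X)

variable {F A}

theorem polynomialUlim_sum (N : ℕ) (c : ℕ → ∀ p, A p) :
    polynomialUlim F A (∑ k ∈ Finset.range N, Polynomial.monomial k (ulim F (c k))) =
      ulim F fun p => ∑ k ∈ Finset.range N, Polynomial.monomial k (c k p) := by
  have h : (fun p => ∑ k ∈ Finset.range N, Polynomial.monomial k (c k p)) =
      ∑ k ∈ Finset.range N, (fun p => (Polynomial.C (c k p) : Polynomial (A p))) *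
        (fun _ => Polynomial.X) ^ k := by
    ext1 p
    simp [Finset.sum_apply, Polynomial.C_mul_X_pow_eq_monomial]
  rw [h, map_sum, map_sum]
  refine Finset.sum_congr rfl fun k _ => ?_
  rw [← Polynomial.C_mul_X_pow_eq_monomial]
  simp [polynomialUlim, ulimMap_ulim]

theorem ulim_coeff_eq {g : Polynomial (Ulim F A)} {gp : ∀ p, Polynomial (A p)}
    (h : ulim F gp = polynomialUlim F A g) (k : ℕ) :
    ulim F (fun p => (gp p).coeff k) = g.coeff k := by
  obtain ⟨c, hc⟩ := exists_ulim_eq F fun k => g.coeff k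
  have hg : g = ∑ k ∈ Finset.range (g.natDegree + 1), Polynomial.monomial k (ulim F (c k)) := by
    simp only [hc]
    exact g.as_sum_range
  have h' := h
  rw [hg, polynomialUlim_sum, ulim_eq_iff] at h'
  have hle : ulim F (fun p => (gp p).coeff k) =
      ulim F fun p => if k < g.natDegree + 1 then c k p else 0 := by
    rw [ulim_eq_iff]
    filter_upwards [h'] with p hp
    rw [hp, Polynomial.finsetSum_coeff]
    simp [Polynomial.coeff_monomial]
  rw [hle]
  split_ifs with hk
  · exact hc k
  · rw [Polynomial.coeff_eq_zero_of_natDegree_lt (by omega)]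
    exact map_zero (ulim F)

theorem polynomialUlim_injective : Function.Injective (polynomialUlim F A) := by
  rw [injective_iff_map_eq_zero]
  intro g hg
  ext k
  rw [← ulim_coeff_eq (gp := fun _ => 0) (by rw [hg]; exact map_zero (ulim F))]
  simp only [Polynomial.coeff_zero]
  exact map_zero (ulim F)

theorem exists_polynomialUlim_eq {gp : ∀ p, Polynomial (A p)} (D : ℕ)
    (h : ∀ᶠ p in (F : Filter Nat.Primes), (gp p).natDegree ≤ D) :
    ∃ g, polynomialUlim F A g = ulim F gp := by
  refine ⟨_, (polynomialUlim_sum (D + 1) fun k p => (gp p).coeff k).trans ?_⟩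
  rw [ulim_eq_iff]
  filter_upwards [h] with p hp
  exact ((gp p).as_sum_range' _ (Nat.lt_succ_of_le hp)).symm

theorem eventually_natDegree_le {g : Polynomial (Ulim F A)} {gp : ∀ p, Polynomial (A p)}
    (h : ulim F gp = polynomialUlim F A g) :
    ∀ᶠ p in (F : Filter Nat.Primes), (gp p).natDegree ≤ g.natDegree := by
  obtain ⟨c, hc⟩ := exists_ulim_eq F fun k => g.coeff k
  have hg : g = ∑ k ∈ Finset.range (g.natDegree + 1), Polynomial.monomial k (ulim F (c k)) := by
    simp only [hc]
    exact g.as_sum_range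
  have h' := h
  rw [hg, polynomialUlim_sum, ulim_eq_iff] at h'
  filter_upwards [h'] with p hp
  rw [hp]
  refine Polynomial.natDegree_sum_le_of_forall_le _ _ fun k hk => ?_
  exact (Polynomial.natDegree_monomial_le _).trans (by simpa [Nat.lt_succ_iff] using hk)

theorem eventually_monic {g : Polynomial (Ulim F A)} (hg : g.Monic) {gp : ∀ p, Polynomial (A p)}
    (h : ulim F gp = polynomialUlim F A g) :
    ∀ᶠ p in (F : Filter Nat.Primes), (gp p).Monic := by
  have h1 := (ulim_coeff_eq h g.natDegree).trans
    (hg.coeff_natDegree.trans (map_one (ulim F)).symm)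
  rw [ulim_eq_iff] at h1
  filter_upwards [h1, eventually_natDegree_le h] with p h2 h3
  exact Polynomial.monic_of_natDegree_le_of_coeff_eq_one _ h3 h2

/-- Linear equations over `R[X]` with a monic coefficient have, in the ultraproduct of the
polynomial rings, only combinations of standard solutions, if this is so over `R`. -/
theorem mem_span_of_monic {R : Type u} [CommRing R] {φ : R →+* Ulim F A} (hφ : φ.Flat) {l : ℕ}
    (f : Fin l → Polynomial R) (i₀ : Fin l) (hf : (f i₀).Monic)
    (x : Fin l → Ulim F fun p => Polynomial (A p))
    (hx : ∑ i, (polynomialUlim F A).comp (Polynomial.mapRingHom φ) (f i) * x i = 0) :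
    x ∈ Submodule.span (Ulim F fun p => Polynomial (A p))
      {s : Fin l → Ulim F fun p => Polynomial (A p) | ∃ t : Fin l → Polynomial R,
        ∑ i, f i * t i = 0 ∧ s = (polynomialUlim F A).comp (Polynomial.mapRingHom φ) ∘ t} := by
  classical
  set G := (polynomialUlim F A).comp (Polynomial.mapRingHom φ) with hG
  set N := Submodule.span (Ulim F fun p => Polynomial (A p))
      {s : Fin l → Ulim F fun p => Polynomial (A p) | ∃ t : Fin l → Polynomial R,
        ∑ i, f i * t i = 0 ∧ s = G ∘ t} with hN
  have hNsol : ∀ s ∈ N, ∑ i, G (f i) * s i = 0 := by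
    intro s hs
    induction hs using Submodule.span_induction with
    | mem s hs =>
      obtain ⟨t, ht, rfl⟩ := hs
      simpa using congrArg G ht
    | zero => simp
    | add s t _ _ hs ht => simp [mul_add, Finset.sum_add_distrib, hs, ht]
    | smul c s _ hs => simp [mul_left_comm _ c, ← Finset.mul_sum, hs]
  obtain ⟨gp, hgp⟩ := exists_ulim_eq F fun i => G (f i)
  obtain ⟨xp, hxp⟩ := exists_ulim_eq F x
  have hmonic := eventually_monic (hf.map φ) (hgp i₀)
  have hdeg : ∀ᶠ p in (F : Filter Nat.Primes), ∀ i,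
      (gp i p).natDegree ≤ ((f i).map φ).natDegree :=
    eventually_all.2 fun i => eventually_natDegree_le (hgp i)
  -- Subtracting multiples of the Koszul solutions `σ i = f_{i₀} e_i - f_i e_{i₀}`, with the
  -- quotients by the monic coefficient as multipliers, replaces each coordinate other than `i₀` by
  -- a remainder.
  let Q : Fin l → Ulim F fun p => Polynomial (A p) := fun i => ulim F fun p => xp i p /ₘ gp i₀ p
  let σ : Fin l → Fin l → Ulim F fun p => Polynomial (A p) := fun i =>
    G ∘ (Pi.single i (f i₀) - Pi.single i₀ (f i))
  have hσ : ∑ i, Q i • σ i ∈ N := by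
    refine Submodule.sum_mem _ fun i _ =>
      Submodule.smul_mem _ _ (Submodule.subset_span ⟨_, ?_, rfl⟩)
    simp [mul_sub, Finset.sum_sub_distrib, Pi.single_apply, mul_comm]
  set y := x - ∑ i, Q i • σ i with hy
  suffices hyN : y ∈ N by
    rw [show x = y + ∑ i, Q i • σ i by rw [hy, sub_add_cancel]]
    exact add_mem hyN hσ
  have hysol : ∑ i, G (f i) * y i = 0 := by
    have := hNsol _ hσ
    simp only [hy, Pi.sub_apply, mul_sub, Finset.sum_sub_distrib, hx, this, sub_zero]
  have hyr : ∀ i, i ≠ i₀ → y i = ulim F fun p => xp i p %ₘ gp i₀ p := by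
    intro i hi
    have h1 : (∑ j, Q j • σ j) i = Q i * G (f i₀) := by
      simp only [Finset.sum_apply, Pi.smul_apply, smul_eq_mul]
      rw [Finset.sum_eq_single i]
      · simp [σ, hi]
      · intro j _ hj
        simp [σ, hi, hj.symm]
      · simp
    rw [hy, Pi.sub_apply, h1, ← hxp, ← hgp, ← map_mul, ← map_sub, ulim_eq_iff]
    -- The division identity also holds when the divisor is not monic: the quotient is then `0` by
    -- convention.
    refine Eventually.of_forall fun p => ?_
    simp only [Pi.sub_apply, Pi.mul_apply]
    rw [sub_eq_iff_eq_add, mul_comm, Polynomial.modByMonic_add_div]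
  obtain ⟨b, hb⟩ := Ideal.Quotient.mk_surjective (y i₀)
  -- The equation expresses `f_{i₀} y_{i₀}` through terms of bounded degree, and degrees add on
  -- multiplication by a monic polynomial.
  have hbdeg : ∃ D : ℕ, ∀ᶠ p in (F : Filter Nat.Primes), (b p).natDegree ≤ D := by
    have h1 : ulim F (fun p => gp i₀ p * b p + ∑ i ∈ Finset.univ.erase i₀,
        gp i p * (xp i p %ₘ gp i₀ p)) = 0 := by
      rw [← hysol, ← Finset.add_sum_erase _ _ (Finset.mem_univ i₀), ← hb, ← hgp]
      have : (fun p => gp i₀ p * b p + ∑ i ∈ Finset.univ.erase i₀,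
          gp i p * (xp i p %ₘ gp i₀ p)) = gp i₀ * b + ∑ i ∈ Finset.univ.erase i₀,
          gp i * (fun p => xp i p %ₘ gp i₀ p) := by
        ext1 p; simp [Finset.sum_apply]
      rw [this, map_add, map_mul, map_sum]
      congr 1
      refine Finset.sum_congr rfl fun i hi => ?_
      rw [map_mul, hgp, hyr i (Finset.ne_of_mem_erase hi)]
    rw [ulim_eq_zero_iff] at h1
    refine ⟨∑ i, ((f i).map φ).natDegree + ((f i₀).map φ).natDegree, ?_⟩
    filter_upwards [h1, hmonic, hdeg] with p h2 h3 h4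
    rcases eq_or_ne (b p) 0 with h5 | h5
    · simp [h5]
    · have h6 := h3.natDegree_mul' h5
      rw [eq_neg_of_add_eq_zero_left h2, Polynomial.natDegree_neg] at h6
      refine (Nat.le_add_left _ _).trans (h6.symm.le.trans ?_)
      refine Polynomial.natDegree_sum_le_of_forall_le _ _ fun i _ => ?_
      refine Polynomial.natDegree_mul_le.trans (add_le_add ((h4 i).trans ?_)
        ((Polynomial.natDegree_modByMonic_le _ h3).trans (h4 i₀)))
      exact Finset.single_le_sum (f := fun i => ((f i).map φ).natDegree)
        (fun _ _ => Nat.zero_le _) (Finset.mem_univ i)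
  have hyim : ∀ i, ∃ z, polynomialUlim F A z = y i := by
    intro i
    rcases eq_or_ne i i₀ with rfl | hi
    · obtain ⟨D, hD⟩ := hbdeg
      rw [← hb]
      exact exists_polynomialUlim_eq D hD
    · rw [hyr i hi]
      refine exists_polynomialUlim_eq ((f i₀).map φ).natDegree ?_
      filter_upwards [hmonic, hdeg] with p h3 h4
      exact (Polynomial.natDegree_modByMonic_le _ h3).trans (h4 i₀)
  choose z hz using hyim
  -- With all degrees bounded, the solution comes from polynomials over the ultraproduct, where
  -- flatness of `R[X] → (ulim A_p)[X]` applies.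
  have hzsol : ∑ i, Polynomial.mapRingHom φ (f i) * z i = 0 := by
    apply polynomialUlim_injective
    rw [map_zero, ← hysol, map_sum]
    refine Finset.sum_congr rfl fun i _ => ?_
    rw [map_mul, hz]
    rfl
  have hspan := (RingHom.flat_iff_mem_span _).1 (Polynomial.flat_mapRingHom hφ) l f z hzsol
  obtain ⟨k, c, t, ht⟩ := Submodule.mem_span_set'.1 hspan
  have hyt : y = ∑ j, polynomialUlim F A (c j) • (polynomialUlim F A ∘ (t j : Fin l → _)) := by
    ext1 i
    rw [← hz, ← ht]
    simp [Finset.sum_apply]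
  rw [hyt]
  refine Submodule.sum_mem _ fun j _ => Submodule.smul_mem _ _ (Submodule.subset_span ?_)
  obtain ⟨s, hs1, hs2⟩ := (t j).2
  exact ⟨s, hs1, by rw [hs2]; rfl⟩

end PolynomialHull

/-! ## Nagata's change of variables -/

section Nagata

open MvPolynomial

/-- The endomorphism `X_0 ↦ X_0`, `X_i ↦ X_i + c X_0 ^ (b ^ i)`. -/
noncomputable def nagataHom (k : Type*) [CommRing k] (n b : ℕ) (c : k) :
    MvPolynomial (Fin (n + 1)) k →ₐ[k] MvPolynomial (Fin (n + 1)) k :=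
  aeval fun i => if i = 0 then X 0 else X i + c • X 0 ^ b ^ i.1

theorem nagataHom_comp (k : Type*) [CommRing k] (n b : ℕ) (c : k) :
    (nagataHom k n b c).comp (nagataHom k n b (-c)) = AlgHom.id _ _ := by
  rw [nagataHom, nagataHom, comp_aeval, ← MvPolynomial.aeval_X_left]
  ext i v
  cases i using Fin.cases <;> simp

/-- Nagata's change of variables, followed by the identification of
`k[x_0, …, x_n]` with `k[x_1, …, x_n][x_0]`. -/
noncomputable def nagataEquiv (k : Type*) [CommRing k] (n b : ℕ) :
    MvPolynomial (Fin (n + 1)) k ≃ₐ[k] Polynomial (MvPolynomial (Fin n) k) :=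
  (AlgEquiv.ofAlgHom (nagataHom k n b 1) (nagataHom k n b (-1)) (nagataHom_comp k n b 1)
    (by simpa using nagataHom_comp k n b (-1))).trans (finSuccEquiv k n)

theorem nagataEquiv_C {k : Type*} [CommRing k] (n b : ℕ) (c : k) :
    nagataEquiv k n b (C c) = Polynomial.C (C c) := by
  rw [← algebraMap_eq, AlgEquiv.commutes]
  rfl

theorem nagataEquiv_X_zero {k : Type*} [CommRing k] (n b : ℕ) :
    nagataEquiv k n b (X 0) = Polynomial.X := by
  simp [nagataEquiv, nagataHom, finSuccEquiv_X_zero]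

theorem nagataEquiv_X_succ {k : Type*} [CommRing k] (n b : ℕ) (i : Fin n) :
    nagataEquiv k n b (X i.succ) =
      Polynomial.C (X i) + Polynomial.X ^ b ^ (i.1 + 1) := by
  simp [nagataEquiv, nagataHom, finSuccEquiv_X_zero, finSuccEquiv_X_succ, Fin.succ_ne_zero]

theorem leadingCoeff_nagataEquiv_X {k : Type*} [Field k] {n b : ℕ} (hb : 0 < b)
    (i : Fin (n + 1)) : (nagataEquiv k n b (X i)).leadingCoeff = 1 ∧
      (nagataEquiv k n b (X i)).natDegree = b ^ i.1 := by
  cases i using Fin.cases with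
  | zero => simp [nagataEquiv_X_zero]
  | succ i =>
    rw [nagataEquiv_X_succ, add_comm]
    have : 0 < b ^ (i.1 + 1) := pow_pos hb _
    exact ⟨Polynomial.leadingCoeff_X_pow_add_C this, Polynomial.natDegree_X_pow_add_C⟩

/-- Each variable becomes monic of degree `b ^ i` in the distinguished variable, and over a domain
degrees add and leading coefficients multiply. -/
theorem nagataEquiv_monomial {k : Type*} [Field k] {n b : ℕ} (hb : 0 < b)
    (v : Fin (n + 1) →₀ ℕ) {c : k} (hc : c ≠ 0) :
    (nagataEquiv k n b (monomial v c)).leadingCoeff = C c ∧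
      (nagataEquiv k n b (monomial v c)).natDegree = ∑ i, b ^ i.1 * v i := by
  have hX := leadingCoeff_nagataEquiv_X (k := k) (n := n) hb
  have hX0 : ∀ i, nagataEquiv k n b (X i) ≠ 0 := fun i =>
    Polynomial.leadingCoeff_ne_zero.1 (by rw [(hX i).1]; exact one_ne_zero)
  rw [monomial_eq, Finsupp.prod_fintype _ _ (fun _ => pow_zero _), map_mul, map_prod,
    nagataEquiv_C]
  simp only [map_pow]
  constructor
  · rw [Polynomial.leadingCoeff_mul, Polynomial.leadingCoeff_prod]
    simp [Polynomial.leadingCoeff_pow, hX]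
  · have h0 : ∀ i, nagataEquiv k n b (X i) ^ v i ≠ 0 := fun i => pow_ne_zero _ (hX0 i)
    rw [Polynomial.natDegree_mul (by simpa using hc) (Finset.prod_ne_zero_iff.2 fun i _ => h0 i),
      Polynomial.natDegree_prod _ _ fun i _ => h0 i, Polynomial.natDegree_C, zero_add]
    refine Finset.sum_congr rfl fun i _ => ?_
    rw [Polynomial.natDegree_pow, (hX i).2, mul_comm]

/-- Both sums are base-`b` expansions, whose digits are unique. -/
theorem sum_pow_mul_injective {n b : ℕ} (hb : 1 < b) {v w : Fin (n + 1) →₀ ℕ}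
    (hv : ∀ i, v i < b) (hw : ∀ i, w i < b)
    (h : ∑ i, b ^ i.1 * v i = ∑ i, b ^ i.1 * w i) : v = w := by
  refine Finsupp.ext <| congrFun <| List.ofFn_inj.mp ?_
  apply Nat.ofDigits_inj_of_len_eq hb (by simp) (by grind) (by grind)
  simpa only [Nat.ofDigits_eq_sum_mapIdx, List.mapIdx_eq_ofFn, List.get_ofFn, List.length_ofFn,
    Fin.val_cast, mul_comm, List.sum_ofFn] using! h

/-- After a suitable change of variables, a nonzero polynomial has a constant leading
coefficient with respect to the first variable. -/
theorem exists_isUnit_leadingCoeff_nagataEquiv {k : Type*} [Field k] {n : ℕ}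
    {f : MvPolynomial (Fin (n + 1)) k} (hf : f ≠ 0) :
    ∃ b, IsUnit (nagataEquiv k n b f).leadingCoeff := by
  classical
  -- `b` exceeds every exponent of `f`, so distinct monomials acquire distinct degrees and the top
  -- one cannot cancel. The summand `2` ensures `1 < b` even for constants.
  set b := 2 + f.totalDegree with hb
  refine ⟨b, ?_⟩
  have hlt : ∀ v ∈ f.support, ∀ i, v i < b := fun v hv i =>
    lt_of_le_of_lt ((monomial_le_degreeOf i hv).trans (degreeOf_le_totalDegree f i)) (by omega)
  have hm := fun v (hv : v ∈ f.support) =>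
    nagataEquiv_monomial (b := b) (by omega) v (mem_support_iff.1 hv)
  obtain ⟨v, hv, hmax⟩ := Finset.exists_max_image f.support
    (fun v => (nagataEquiv k n b (monomial v (coeff v f))).natDegree) (support_nonempty.2 hf)
  have hne : nagataEquiv k n b (monomial v (coeff v f)) ≠ 0 := by
    rw [← Polynomial.leadingCoeff_ne_zero, (hm v hv).1]
    simpa using hv
  have hlead : (nagataEquiv k n b f).leadingCoeff =
      (nagataEquiv k n b (monomial v (coeff v f))).leadingCoeff := by
    conv_lhs => rw [← f.support_sum_monomial_coeff, ← Finset.add_sum_erase _ _ hv]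
    rw [map_add, map_sum, add_comm]
    apply Polynomial.leadingCoeff_add_of_degree_lt
    refine lt_of_le_of_lt (Polynomial.degree_sum_le _ _) ?_
    refine (Finset.sup_lt_iff (bot_lt_iff_ne_bot.2 (mt Polynomial.degree_eq_bot.1 hne))).2
      fun w hw => ?_
    obtain ⟨hwv, hw⟩ := Finset.mem_erase.1 hw
    refine Polynomial.degree_lt_degree (lt_of_le_of_ne (hmax w hw) fun h => hwv ?_)
    rw [(hm w hw).2, (hm v hv).2] at h
    exact sum_pow_mul_injective (by omega) (hlt w hw) (hlt v hv) h
  rw [hlead, (hm v hv).1]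
  exact (isUnit_iff_ne_zero.2 (mem_support_iff.1 hv)).map C

end Nagata

/-! ## Flatness of the hull of a polynomial ring -/

section Flat

variable (F : Ultrafilter Nat.Primes) (α : Ulim F FpBar ≃+* ℂ)

/-- The change of variables is given by the same integral formulas over every ring, so it commutes
with passage to the hull. -/
theorem ulimMap_nagataEquiv_polyHull (n b : ℕ) (f : MvPolynomial (Fin (n + 1)) ℂ) :
    ulimMap F (fun p => (nagataEquiv (FpBar p) n b).toRingEquiv.toRingHom)
        (polyHull F α (n + 1) f) =
      (polynomialUlim F fun p => MvPolynomial (Fin n) (FpBar p)).comp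
        (Polynomial.mapRingHom (polyHull F α n)) (nagataEquiv ℂ n b f) := by
  have h : (ulimMap F (fun p => (nagataEquiv (FpBar p) n b).toRingEquiv.toRingHom)).comp
        (polyHull F α (n + 1)) =
      ((polynomialUlim F fun p => MvPolynomial (Fin n) (FpBar p)).comp
        (Polynomial.mapRingHom (polyHull F α n))).comp
          (nagataEquiv ℂ n b).toRingEquiv.toRingHom := by
    apply MvPolynomial.ringHom_ext
    · intro c
      obtain ⟨c, rfl⟩ := α.surjective c
      obtain ⟨c, rfl⟩ := Ideal.Quotient.mk_surjective c
      simp [polyHull_C, ulimMap_ulim, nagataEquiv_C, polynomialUlim]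
    · intro i
      cases i using Fin.cases with
      | zero => simp [polyHull_X, ulimMap_ulim, nagataEquiv_X_zero, polynomialUlim]
      | succ i =>
        simp only [RingHom.comp_apply, polyHull_X, ulimMap_ulim]
        simp [nagataEquiv_X_succ, polynomialUlim, polyHull_X, ulimMap_ulim]
        rfl
  exact RingHom.congr_fun h f

/-- All unit vectors are standard solutions. -/
theorem mem_span_of_forall_eq_zero {A B : Type*} [CommRing A] [CommRing B] (φ : A →+* B) {l : ℕ}
    {f : Fin l → A} (hf : ∀ i, f i = 0) (x : Fin l → B) :
    x ∈ Submodule.span B {s : Fin l → B | ∃ t : Fin l → A, ∑ i, f i * t i = 0 ∧ s = φ ∘ t} := by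
  rw [show x = ∑ i, x i • Pi.single i 1 by ext j; simp [Finset.sum_apply, Pi.single_apply]]
  refine Submodule.sum_mem _ fun i _ => Submodule.smul_mem _ _ (Submodule.subset_span ?_)
  refine ⟨Pi.single i 1, by simp [hf], ?_⟩
  ext j
  rcases eq_or_ne j i with rfl | h <;> simp [*]

/-- Transport of the solutions of linear equations along isomorphisms, with a rescaling. -/
theorem mem_span_of_transport {A A' B B' : Type*} [CommRing A] [CommRing A'] [CommRing B]
    [CommRing B'] {H : A →+* B} {G : A' →+* B'} (Θ : A ≃+* A') (T : B →+* B') (T' : B' →+* B)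
    (hT : ∀ y, T' (T y) = y) (hcomm : ∀ g, T (H g) = G (Θ g)) {v w : A'} (hwv : w * v = 1)
    {l : ℕ} {f : Fin l → A} {x : Fin l → B} (hx : ∑ i, H (f i) * x i = 0)
    (h : ∑ i, G (v * Θ (f i)) * T (x i) = 0 → (fun i => T (x i)) ∈ Submodule.span B'
      {s : Fin l → B' | ∃ t : Fin l → A', ∑ i, v * Θ (f i) * t i = 0 ∧ s = G ∘ t}) :
    x ∈ Submodule.span B {s : Fin l → B | ∃ t : Fin l → A, ∑ i, f i * t i = 0 ∧ s = H ∘ t} := by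
  have hcomm' : ∀ g, T' (G g) = H (Θ.symm g) := by
    intro g
    obtain ⟨g, rfl⟩ := Θ.surjective g
    rw [← hcomm, hT, RingEquiv.symm_apply_apply]
  obtain ⟨k, c, t, ht⟩ := Submodule.mem_span_set'.1 (h (by
    have := congrArg (fun y => G v * T y) hx
    simpa [Finset.mul_sum, hcomm, mul_assoc] using this))
  have hxt : x = ∑ j, T' (c j) • (T' ∘ (t j : Fin l → _)) := by
    ext1 i
    rw [← hT (x i), ← congrFun ht i]
    simp [Finset.sum_apply]
  rw [hxt]
  refine Submodule.sum_mem _ fun j _ => Submodule.smul_mem _ _ (Submodule.subset_span ?_)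
  obtain ⟨s, hs1, hs2⟩ := (t j).2
  refine ⟨fun i => Θ.symm (s i), ?_, ?_⟩
  · apply Θ.injective
    have h1 := congrArg (fun y => w * y) hs1
    simp only [mul_zero, Finset.mul_sum, ← mul_assoc, hwv, one_mul] at h1
    simpa using h1
  · ext i
    rw [hs2]
    exact hcomm' _

/-- The hull of a polynomial ring is flat. -/
theorem polyHull_flat (n : ℕ) : (polyHull F α n).Flat := by
  induction n with
  | zero =>
    refine RingHom.Flat.of_isField ?_ _
    exact MulEquiv.isField (Field.toIsField ℂ)
      (MvPolynomial.isEmptyRingEquiv ℂ (Fin 0)).toMulEquiv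
  | succ n ih =>
    rw [RingHom.flat_iff_mem_span]
    intro l f x hx
    by_cases hf : ∀ i, f i = 0
    · exact mem_span_of_forall_eq_zero _ hf x
    push Not at hf
    obtain ⟨i₀, hi₀⟩ := hf
    obtain ⟨b, u, hu⟩ := exists_isUnit_leadingCoeff_nagataEquiv hi₀
    -- Scaling by the inverse of the unit leading coefficient `u` makes the coefficient at `i₀`
    -- monic; `w` undoes the scaling.
    refine mem_span_of_transport (G := (polynomialUlim F fun p =>
        MvPolynomial (Fin n) (FpBar p)).comp (Polynomial.mapRingHom (polyHull F α n)))
      (nagataEquiv ℂ n b).toRingEquiv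
      (ulimMap F (fun p => (nagataEquiv (FpBar p) n b).toRingEquiv.toRingHom))
      (ulimMap F (fun p => (nagataEquiv (FpBar p) n b).symm.toRingEquiv.toRingHom)) (fun y => ?_)
      (fun g => ulimMap_nagataEquiv_polyHull F α n b g) (v := Polynomial.C (↑u⁻¹))
      (w := Polynomial.C (↑u : MvPolynomial (Fin n) ℂ)) ?_ hx fun hx' => ?_
    · obtain ⟨y, rfl⟩ := Ideal.Quotient.mk_surjective y
      rw [ulimMap_ulim, ulimMap_ulim, ulim_eq_iff]
      exact Eventually.of_forall fun p => (nagataEquiv (FpBar p) n b).symm_apply_apply _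
    · rw [← map_mul, Units.mul_inv, map_one]
    · refine mem_span_of_monic ih _ i₀ ?_ _ hx'
      change (Polynomial.C _ * nagataEquiv ℂ n b (f i₀)).Monic
      rw [Polynomial.Monic, Polynomial.leadingCoeff_mul, Polynomial.leadingCoeff_C, ← hu,
        Units.inv_mul]

end Flat

/-! ## Affine domains are birational to hypersurfaces -/

attribute [local instance] FractionRing.liftAlgebra in
/-- A finite extension of domains of characteristic zero is generated by one element, up to
denominators from the base. -/
theorem exists_generator_up_to_denominators (R B : Type u) [CommRing R] [IsDomain R] [CharZero R]
    [CommRing B] [IsDomain B] [Algebra R B] [FaithfulSMul R B] [Module.Finite R B] :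
    ∃ z : B, ∀ b : B, ∃ s : R, s ≠ 0 ∧ ∃ q : Polynomial R,
      algebraMap R B s * b = Polynomial.aeval z q := by
  let M := FractionRing R
  let L := FractionRing B
  have : CharZero M := charZero_of_injective_algebraMap (IsFractionRing.injective R M)
  have : FiniteDimensional M L := inferInstance
  -- Characteristic zero makes the extension of fraction fields separable. Elements of `L` have
  -- denominators from `R`, so the primitive element may be moved into `B`.
  obtain ⟨θ, hθ⟩ := Field.exists_primitive_element M L
  obtain ⟨z, ⟨_, r, hr, rfl⟩, hz⟩ :=
    IsLocalization.exists_mk'_eq (Algebra.algebraMapSubmonoid B (nonZeroDivisors R)) θ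
  rw [IsLocalization.mk'_eq_iff_eq_mul, mul_comm] at hz
  have hr0 : algebraMap R M r ≠ 0 := by
    simpa using nonZeroDivisors.ne_zero hr
  have hθz : θ = (algebraMap R M r)⁻¹ • algebraMap B L z := by
    rw [hz, eq_inv_smul_iff₀ hr0, Algebra.smul_def, ← IsScalarTower.algebraMap_apply,
      IsScalarTower.algebraMap_apply R B L]
  have htop : IntermediateField.adjoin M {algebraMap B L z} = ⊤ := by
    rw [eq_top_iff, ← hθ, IntermediateField.adjoin_simple_le_iff, hθz]
    exact IntermediateField.smul_mem _ (IntermediateField.mem_adjoin_simple_self M _)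
  refine ⟨z, fun b => ?_⟩
  have hb : algebraMap B L b ∈ (IntermediateField.adjoin M {algebraMap B L z}).toSubalgebra := by
    rw [htop]; trivial
  rw [IntermediateField.adjoin_simple_toSubalgebra_of_isAlgebraic
    (Algebra.IsAlgebraic.isAlgebraic _), Algebra.adjoin_singleton_eq_range_aeval] at hb
  obtain ⟨g, hg⟩ := hb
  obtain ⟨s, hs0, hs⟩ := IsLocalization.integerNormalization_spec (nonZeroDivisors R) g
  refine ⟨s, nonZeroDivisors.ne_zero hs0,
    IsLocalization.integerNormalization (nonZeroDivisors R) g, ?_⟩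
  apply IsFractionRing.injective B L
  have h2 := congrArg (Polynomial.aeval (algebraMap B L z)) hs
  rw [Polynomial.aeval_map_algebraMap, Polynomial.aeval_algebraMap_apply,
    ← IsScalarTower.algebraMap_smul M s g, map_smul] at h2
  have h3 : Polynomial.aeval (algebraMap B L z) g = algebraMap B L b := hg
  rw [h2, h3, map_mul, ← IsScalarTower.algebraMap_apply, Algebra.smul_def,
    ← IsScalarTower.algebraMap_apply]

open MvPolynomial in
/-- An affine domain over a field of characteristic zero is birational to a hypersurface. -/
theorem exists_birational_hypersurface (K B : Type) [Field K] [CharZero K] [CommRing B]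
    [IsDomain B] [Algebra K B] [Algebra.FiniteType K B] :
    ∃ (d : ℕ) (y : Fin d → B) (h : MvPolynomial (Fin d) K), Irreducible h ∧
      (∀ g, aeval y g = 0 ↔ h ∣ g) ∧
      ∀ b : B, ∃ s q : MvPolynomial (Fin d) K, ¬ h ∣ s ∧ aeval y s * b = aeval y q := by
  -- By Noether normalization `B` is finite over a polynomial ring; adding a generator `z` of the
  -- fraction field gives `d + 1` coordinates that satisfy a single equation.
  obtain ⟨d, g, hg, hfin⟩ := exists_finite_inj_algHom_of_fg K B
  let _ : Algebra (MvPolynomial (Fin d) K) B := g.toRingHom.toAlgebra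
  have : IsScalarTower K (MvPolynomial (Fin d) K) B :=
    IsScalarTower.of_algebraMap_eq fun c => (g.commutes c).symm
  have : Module.Finite (MvPolynomial (Fin d) K) B := hfin
  have : FaithfulSMul (MvPolynomial (Fin d) K) B :=
    (faithfulSMul_iff_algebraMap_injective _ B).2 hg
  have : CharZero (MvPolynomial (Fin d) K) :=
    charZero_of_injective_algebraMap (MvPolynomial.C_injective (Fin d) K)
  obtain ⟨z, hz⟩ := exists_generator_up_to_denominators (MvPolynomial (Fin d) K) B
  have hzint : IsIntegral (MvPolynomial (Fin d) K) z := Algebra.IsIntegral.isIntegral z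
  let y : Fin (d + 1) → B := Fin.cons z fun i => g (X i)
  let e := finSuccEquiv K d
  have heval : ∀ f, aeval y f = Polynomial.aeval z (e f) := by
    intro f
    have : aeval y = ((Polynomial.aeval z).restrictScalars K).comp e.toAlgHom := by
      ext i
      cases i using Fin.cases with
      | zero => simp [y, e, finSuccEquiv_X_zero]
      | succ i =>
        simp [y, e, finSuccEquiv_X_succ]
        rfl
    exact DFunLike.congr_fun this f
  -- Polynomial rings are integrally closed, so the minimal polynomial of `z` over the base ring
  -- divides every relation.
  have hdvd : ∀ f, aeval y f = 0 ↔ e.symm (minpoly (MvPolynomial (Fin d) K) z) ∣ f := by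
    intro f
    rw [heval, minpoly.isIntegrallyClosed_dvd_iff hzint, ← map_dvd_iff e, e.apply_symm_apply]
  refine ⟨d + 1, y, e.symm (minpoly (MvPolynomial (Fin d) K) z), ?_, hdvd, fun b => ?_⟩
  · rw [MulEquiv.irreducible_iff]
    exact (minpoly.prime_of_isIntegrallyClosed hzint).irreducible
  · obtain ⟨s, hs, q, hq⟩ := hz b
    refine ⟨e.symm (Polynomial.C s), e.symm q, ?_, ?_⟩
    · rw [← hdvd, heval, e.apply_symm_apply, Polynomial.aeval_C]
      exact fun h0 => hs ((map_eq_zero_iff _ hg).1 h0)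
    · rw [heval, heval, e.apply_symm_apply, e.apply_symm_apply, Polynomial.aeval_C, hq]

open MvPolynomial in
/-- An affine variety in characteristic zero is birational to a hypersurface: the ideal-theoretic
form of `exists_birational_hypersurface`. -/
theorem exists_hypersurface {K : Type} [Field K] [CharZero K] {n : ℕ}
    (P : Ideal (MvPolynomial (Fin n) K)) [P.IsPrime] :
    ∃ (d : ℕ) (Y : Fin d → MvPolynomial (Fin n) K) (h s : MvPolynomial (Fin d) K)
      (q : Fin n → MvPolynomial (Fin d) K), Irreducible h ∧
        (∀ g, aeval Y g ∈ P ↔ h ∣ g) ∧ ¬ h ∣ s ∧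
          ∀ i, aeval Y s * X i - aeval Y (q i) ∈ P := by
  classical
  obtain ⟨d, y, h, hirr, hdvd, hfrac⟩ :=
    exists_birational_hypersurface K (MvPolynomial (Fin n) K ⧸ P)
  choose Y hY using fun i => Ideal.Quotient.mkₐ_surjective K P (y i)
  choose s q hs hq using fun i => hfrac (Ideal.Quotient.mkₐ K P (X i))
  have heval : ∀ g : MvPolynomial (Fin d) K, Ideal.Quotient.mkₐ K P (aeval Y g) = aeval y g := by
    intro g
    obtain rfl : (fun i => Ideal.Quotient.mkₐ K P (Y i)) = y := funext hY
    exact comp_aeval_apply _ _ g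
  have hmem : ∀ g, g ∈ P ↔ Ideal.Quotient.mkₐ K P g = 0 := fun g =>
    (Ideal.Quotient.eq_zero_iff_mem).symm
  -- The product is a common denominator for all variables; being prime, `h` does not divide it.
  refine ⟨d, Y, h, ∏ i, s i, fun i => q i * ∏ j ∈ Finset.univ.erase i, s j, hirr, fun g => ?_,
    fun hd => ?_, fun i => ?_⟩
  · rw [hmem, heval, hdvd]
  · obtain ⟨i, -, hi⟩ := (hirr.prime.dvd_finsetProd_iff _).1 hd
    exact hs i hi
  · rw [hmem, map_sub, map_mul, heval, heval, ← Finset.mul_prod_erase _ _ (Finset.mem_univ i),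
      map_mul, map_mul, ← hq, sub_eq_zero]
    ring

/-! ## Approximations of ideals -/

namespace IsIdealApprox

variable {F : Ultrafilter Nat.Primes} {R : Type v} [CommRing R] {A : Nat.Primes → Type u}
  [∀ p, CommRing (A p)] {ι : R →+* Ulim F A} {J : Ideal R} {Jp : ∀ p, Ideal (A p)}

/-- The number of generators does not depend on `p`, so coefficients chosen for each `p` assemble to
coefficients in the ultraproduct, and conversely. -/
theorem ulim_mem_map_iff (h : IsIdealApprox ι J Jp) {x : ∀ p, A p} :
    ulim F x ∈ J.map ι ↔ ∀ᶠ p in (F : Filter Nat.Primes), x p ∈ Jp p := by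
  obtain ⟨m, g, gp, rfl, hgp, hJ⟩ := h
  rw [Ideal.map_span, ← Set.range_comp, show ι ∘ g = fun j => ulim F (gp j) from
    funext fun j => (hgp j).symm]
  have hsum : ∀ c : Fin m → ∀ p, A p, ∑ j, ulim F (c j) * ulim F (gp j) =
      ulim F fun p => ∑ j, c j p * gp j p := by
    intro c
    simp_rw [← map_mul]
    rw [← map_sum]
    congr 1
    ext1 p
    simp [Finset.sum_apply]
  constructor
  · intro hx
    obtain ⟨c, hc⟩ := (Ideal.mem_span_range_iff_exists_fun (R := Ulim F A)).1 hx
    obtain ⟨cp, hcp⟩ := exists_ulim_eq F c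
    simp_rw [← hcp, hsum] at hc
    rw [ulim_eq_iff] at hc
    filter_upwards [hc, hJ] with p h1 h2
    rw [h2, ← h1]
    exact Ideal.mem_span_range_iff_exists_fun.2 ⟨_, rfl⟩
  · intro hx
    have hex : ∀ p, ∃ c : Fin m → A p, x p ∈ Ideal.span (Set.range fun j => gp j p) →
        ∑ j, c j * gp j p = x p := by
      intro p
      by_cases hp : x p ∈ Ideal.span (Set.range fun j => gp j p)
      · obtain ⟨c, hc⟩ := Ideal.mem_span_range_iff_exists_fun.1 hp
        exact ⟨c, fun _ => hc⟩
      · exact ⟨0, fun h => absurd h hp⟩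
    choose c hc using hex
    refine (Ideal.mem_span_range_iff_exists_fun (R := Ulim F A)).2
      ⟨fun j => ulim F fun p => c p j, ?_⟩
    rw [hsum, ulim_eq_iff]
    filter_upwards [hx, hJ] with p h1 h2
    exact hc p (h2 ▸ h1)

/-- Almost always, the approximation of an ideal is generated by approximations of any given
generators. -/
theorem eventually_eq_span (h : IsIdealApprox ι J Jp) {n : ℕ} {f : Fin n → R}
    (hf : Ideal.span (Set.range f) = J) {fp : Fin n → ∀ p, A p}
    (hfp : ∀ i, ulim F (fp i) = ι (f i)) :
    ∀ᶠ p in (F : Filter Nat.Primes), Jp p = Ideal.span (Set.range fun i => fp i p) := by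
  have h' : IsIdealApprox ι J fun p => Ideal.span (Set.range fun i => fp i p) :=
    ⟨n, f, fp, hf, hfp, Eventually.of_forall fun _ => rfl⟩
  have h1 : ∀ᶠ p in (F : Filter Nat.Primes), ∀ i, fp i p ∈ Jp p := by
    refine eventually_all.2 fun i => h.ulim_mem_map_iff.1 ?_
    rw [hfp]
    exact Ideal.mem_map_of_mem _ (hf ▸ Ideal.subset_span ⟨i, rfl⟩)
  obtain ⟨m, g, gp, hg, hgp, hJ⟩ := h
  have h2 : ∀ᶠ p in (F : Filter Nat.Primes), ∀ j,
      gp j p ∈ Ideal.span (Set.range fun i => fp i p) := by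
    refine eventually_all.2 fun j => h'.ulim_mem_map_iff.1 ?_
    rw [hgp]
    exact Ideal.mem_map_of_mem _ (hg ▸ Ideal.subset_span ⟨j, rfl⟩)
  filter_upwards [h1, h2, hJ] with p h3 h4 h5
  refine le_antisymm ?_ ?_
  · rw [h5, Ideal.span_le]
    rintro _ ⟨j, rfl⟩
    exact h4 j
  · rw [Ideal.span_le]
    rintro _ ⟨i, rfl⟩
    exact h3 i

end IsIdealApprox

/-! ## Approximations of prime ideals -/

/-- An element outside a prime ideal is a nonzerodivisor modulo the extension of this ideal along
a flat homomorphism. -/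
theorem RingHom.Flat.mem_map_of_mul_mem {A : Type u} {B : Type v} [CommRing A] [CommRing B]
    {φ : A →+* B} (hφ : φ.Flat) {P : Ideal A} [hP : P.IsPrime] (hfg : P.FG) {s : A} (hs : s ∉ P)
    {b : B} (hb : φ s * b ∈ P.map φ) : b ∈ P.map φ := by
  obtain ⟨m, g, hg⟩ := Submodule.fg_iff_exists_fin_generating_family.1 hfg
  have hg' : Ideal.span (Set.range g) = P := hg
  have hmap : P.map φ = Ideal.span (Set.range fun j => φ (g j)) := by
    rw [← hg', Ideal.map_span, ← Set.range_comp]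
    rfl
  obtain ⟨c, hc⟩ := Ideal.mem_span_range_iff_exists_fun.1 (hmap ▸ hb)
  -- `(b, -c)` is a relation among the images of `s` and the generators `g` of `P`. In a relation
  -- over `A` the coefficient `t 0` of `s` satisfies `s * t 0 ∈ P`, so it lies in `P`; by flatness
  -- `b` lies in the extension of `P`.
  have hmem := (RingHom.flat_iff_mem_span φ).1 hφ (m + 1) (Fin.cons s g)
    (Fin.cons b fun j => -c j) (by
      simp only [Fin.sum_univ_succ, Fin.cons_zero, Fin.cons_succ, ← hc, neg_mul,
        Finset.sum_neg_distrib, mul_comm (φ (g _)), add_neg_cancel])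
  have hle : Submodule.span B {x : Fin (m + 1) → B | ∃ t : Fin (m + 1) → A,
      ∑ i, (Fin.cons s g : Fin (m + 1) → A) i * t i = 0 ∧ x = φ ∘ t} ≤
      (Submodule.comap (LinearMap.proj 0) (P.map φ) : Submodule B (Fin (m + 1) → B)) := by
    rw [Submodule.span_le]
    rintro _ ⟨t, ht, rfl⟩
    refine Ideal.mem_map_of_mem φ ((hP.mem_or_mem ?_).resolve_left hs)
    simp only [Fin.sum_univ_succ, Fin.cons_zero, Fin.cons_succ] at ht
    rw [eq_neg_of_add_eq_zero_left ht]
    exact neg_mem (sum_mem fun j _ => Ideal.mul_mem_right _ _ (hg' ▸ Ideal.subset_span ⟨j, rfl⟩))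
  exact hle hmem

open MvPolynomial in
/-- If, modulo `P`, the variables are quotients `q_i (Y) / s (Y)`, then every polynomial is a
quotient with denominator a power of `s (Y)`, also after specialization. -/
theorem exists_pow_mul_sub_mem {k E : Type*} [CommRing k] [CommRing E] {n d : ℕ}
    {P : Ideal (MvPolynomial (Fin n) k)} {Y : Fin d → MvPolynomial (Fin n) k}
    {s : MvPolynomial (Fin d) k} {q : Fin n → MvPolynomial (Fin d) k}
    (hq : ∀ i, aeval Y s * X i - aeval Y (q i) ∈ P) (χ : MvPolynomial (Fin n) k →+* E)
    (χ' : MvPolynomial (Fin d) k →+* E) (hC : ∀ c, χ (C c) = χ' (C c))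
    (hX : ∀ i, χ' s * χ (X i) = χ' (q i)) (g : MvPolynomial (Fin n) k) :
    ∃ (N : ℕ) (G : MvPolynomial (Fin d) k),
      aeval Y s ^ N * g - aeval Y G ∈ P ∧ χ' s ^ N * χ g = χ' G := by
  induction g using MvPolynomial.induction_on with
  | C c => exact ⟨0, C c, by simp [algebraMap_eq], by simp [hC]⟩
  | add f g hf hg =>
    obtain ⟨N, G, h1, h2⟩ := hf
    obtain ⟨M, H, h3, h4⟩ := hg
    refine ⟨N + M, s ^ M * G + s ^ N * H, ?_, ?_⟩
    · have := add_mem (Ideal.mul_mem_left _ (aeval Y s ^ M) h1)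
        (Ideal.mul_mem_left _ (aeval Y s ^ N) h3)
      convert this using 1
      simp only [map_add, map_mul, map_pow]
      ring
    · simp only [map_add, map_mul, map_pow, ← h2, ← h4]
      ring
  | mul_X f i hf =>
    obtain ⟨N, G, h1, h2⟩ := hf
    refine ⟨N + 1, G * q i, ?_, ?_⟩
    · have := add_mem (Ideal.mul_mem_right (aeval Y s * X i) _ h1)
        (Ideal.mul_mem_left _ (aeval Y G) (hq i))
      convert this using 1
      simp only [map_mul]
      ring
    · simp only [map_mul, ← h2, ← hX]
      ring

section Prime

open MvPolynomial

variable {F : Ultrafilter Nat.Primes} {α : Ulim F FpBar ≃+* ℂ} {n d : ℕ}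

theorem ulim_aeval {Y : Fin d → MvPolynomial (Fin n) ℂ}
    {Yp : Fin d → ∀ p, MvPolynomial (Fin n) (FpBar p)}
    (hY : ∀ i, ulim F (Yp i) = polyHull F α n (Y i)) {g : MvPolynomial (Fin d) ℂ}
    {gp : ∀ p, MvPolynomial (Fin d) (FpBar p)} (hg : ulim F gp = polyHull F α d g) :
    ulim F (fun p => aeval (fun i => Yp i p) (gp p)) = polyHull F α n (aeval Y g) := by
  have h : (ulimMap F fun p => (aeval (R := FpBar p) fun i => Yp i p).toRingHom).comp
      (polyHull F α d) = (polyHull F α n).comp (aeval (R := ℂ) Y).toRingHom := by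
    apply MvPolynomial.ringHom_ext
    · intro c
      obtain ⟨c, rfl⟩ := α.surjective c
      obtain ⟨c, rfl⟩ := Ideal.Quotient.mk_surjective c
      simp [polyHull_C, ulimMap_ulim, algebraMap_eq]
    · intro i
      simp [polyHull_X, ulimMap_ulim, hY]
  have := RingHom.congr_fun h g
  rw [RingHom.comp_apply, ← hg, ulimMap_ulim] at this
  exact this

/-- Cofactors in characteristic `p` have degree at most that of `s`, so they would lift to a
cofactor over `ℂ`. -/
theorem eventually_not_dvd {h s : MvPolynomial (Fin n) ℂ} (hs : ¬ h ∣ s)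
    {hp sp : ∀ p, MvPolynomial (Fin n) (FpBar p)} (hhp : ulim F hp = polyHull F α n h)
    (hsp : ulim F sp = polyHull F α n s) :
    ∀ᶠ p in (F : Filter Nat.Primes), ¬ hp p ∣ sp p := by
  rw [Ultrafilter.eventually_not]
  intro hdvd
  have hs0 : s ≠ 0 := fun h0 => hs (h0 ▸ dvd_zero h)
  choose! c hc using fun p (hp : hp p ∣ sp p) => hp
  have hdeg : ∀ᶠ p in (F : Filter Nat.Primes), (c p).totalDegree ≤ s.totalDegree := by
    filter_upwards [hdvd, eventually_ne_zero hs0 hsp, eventually_totalDegree_le hsp]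
      with p h1 h2 h3
    rw [hc p h1] at h2 h3
    rw [totalDegree_mul_of_isDomain (left_ne_zero_of_mul h2) (right_ne_zero_of_mul h2)] at h3
    omega
  obtain ⟨c', hc'⟩ := exists_polyHull_eq_of_totalDegree_le (α := α) _ hdeg
  refine hs ⟨c', polyHull_injective (F := F) (α := α) ?_⟩
  rw [map_mul, hc', ← hhp, ← hsp, ← map_mul, ulim_eq_iff]
  filter_upwards [hdvd] with p h1 using hc p h1

/-- A criterion for approximations of `P` to be almost always prime: the affine variety defined
by `P` is birational, via `Y` and the fractions `q_i / s`, to the hypersurface `h = 0`, and the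
coordinate rings of almost all approximations of this hypersurface embed via `χ'` into domains in
which `s` becomes invertible. -/
theorem eventually_isPrime_of_birational {P : Ideal (MvPolynomial (Fin n) ℂ)}
    {Pp : ∀ p, Ideal (MvPolynomial (Fin n) (FpBar p))}
    (hPp : IsIdealApprox (polyHull F α n) P Pp)
    {Y : Fin d → MvPolynomial (Fin n) ℂ} {h s : MvPolynomial (Fin d) ℂ}
    {q : Fin n → MvPolynomial (Fin d) ℂ} (hdvd : ∀ g, aeval Y g ∈ P → h ∣ g)
    (hq : ∀ i, aeval Y s * X i - aeval Y (q i) ∈ P)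
    {Yp : Fin d → ∀ p, MvPolynomial (Fin n) (FpBar p)}
    {hp sp : ∀ p, MvPolynomial (Fin d) (FpBar p)} (hhp : ulim F hp = polyHull F α d h)
    (hsp : ulim F sp = polyHull F α d s) {qp : Fin n → ∀ p, MvPolynomial (Fin d) (FpBar p)}
    (hqp : ∀ i, ulim F (qp i) = polyHull F α d (q i))
    (hhY : ∀ᶠ p in (F : Filter Nat.Primes), aeval (fun i => Yp i p) (hp p) ∈ Pp p)
    (hqY : ∀ᶠ p in (F : Filter Nat.Primes), ∀ i, aeval (fun i => Yp i p) (sp p) * X i -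
      aeval (fun i => Yp i p) (qp i p) ∈ Pp p)
    (hsY : ∀ᶠ p in (F : Filter Nat.Primes), ∀ a, aeval (fun i => Yp i p) (sp p) * a ∈ Pp p →
      a ∈ Pp p)
    {E : Nat.Primes → Type} [∀ p, CommRing (E p)]
    (χ' : ∀ p, MvPolynomial (Fin d) (FpBar p) →+* E p) (hχ' : ∀ p g, χ' p g = 0 ↔ hp p ∣ g)
    (hdom : ∀ᶠ p in (F : Filter Nat.Primes), IsDomain (E p))
    (hunit : ∀ᶠ p in (F : Filter Nat.Primes), IsUnit (χ' p (sp p))) :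
    ∀ᶠ p in (F : Filter Nat.Primes), (Pp p).IsPrime := by
  let x : Fin n → ∀ p, E p := fun i p => Ring.inverse (χ' p (sp p)) * χ' p (qp i p)
  let χ : ∀ p, MvPolynomial (Fin n) (FpBar p) →+* E p := fun p =>
    eval₂Hom ((χ' p).comp C) fun i => x i p
  have hχX : ∀ᶠ p in (F : Filter Nat.Primes), ∀ i,
      χ' p (sp p) * χ p (X i) = χ' p (qp i p) := by
    filter_upwards [hunit] with p h1 i
    simp only [χ, x, coe_eval₂Hom, eval₂_X]
    rw [← mul_assoc, Ring.mul_inverse_cancel _ h1, one_mul]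
  have hχC : ∀ p c, χ p (C c) = χ' p (C c) := by simp [χ]
  let η : MvPolynomial (Fin n) ℂ →+* Ulim F E := (ulimMap F χ).comp (polyHull F α n)
  let η' : MvPolynomial (Fin d) ℂ →+* Ulim F E := (ulimMap F χ').comp (polyHull F α d)
  have hηC : ∀ c, η (C c) = η' (C c) := by
    intro c
    obtain ⟨c, rfl⟩ := α.surjective c
    obtain ⟨c, rfl⟩ := Ideal.Quotient.mk_surjective c
    simp only [η, η', RingHom.comp_apply, polyHull_C, ulimMap_ulim, hχC]
  have hη's : η' s = ulim F fun p => χ' p (sp p) := by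
    simp only [η', RingHom.comp_apply, ← hsp, ulimMap_ulim]
  have hηX : ∀ i, η' s * η (X i) = η' (q i) := by
    intro i
    have h1 : η' (q i) = ulim F fun p => χ' p (qp i p) := by
      simp only [η', RingHom.comp_apply, ← hqp, ulimMap_ulim]
    have h2 : η (X i) = ulim F fun p => χ p (X i) := by
      simp only [η, RingHom.comp_apply, polyHull_X, ulimMap_ulim]
    rw [h1, h2, hη's, ← map_mul, ulim_eq_iff]
    filter_upwards [hχX] with p h3 using h3 i
  have hη'0 : ∀ g, h ∣ g → η' g = 0 := by
    rintro _ ⟨c, rfl⟩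
    have : η' h = 0 := by
      simp only [η', RingHom.comp_apply, ← hhp, ulimMap_ulim]
      rw [ulim_eq_zero_iff]
      exact Eventually.of_forall fun p => (hχ' p _).2 dvd_rfl
    rw [map_mul, this, zero_mul]
  -- Multiplied by a power of `s (Y)`, an element of `P` is congruent to some `G (Y) ∈ P`, so `h`
  -- divides `G` and `η'` kills it; `s` becomes invertible.
  have hηP : ∀ g ∈ P, η g = 0 := by
    intro g hg
    obtain ⟨N, G, h1, h2⟩ := exists_pow_mul_sub_mem hq η η' hηC hηX g
    have hG : aeval Y G ∈ P := by
      have := sub_mem (Ideal.mul_mem_left P (aeval Y s ^ N) hg) h1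
      simpa using this
    rw [hη'0 G (hdvd G hG)] at h2
    obtain ⟨y, hy⟩ := Ideal.Quotient.mk_surjective (η g)
    rw [← hy, hη's, ← map_pow, ← map_mul, ulim_eq_zero_iff] at h2
    rw [← hy, ulim_eq_zero_iff]
    filter_upwards [h2, hunit] with p h3 h4
    exact (h4.pow N).mul_right_eq_zero.1 h3
  obtain ⟨m, g, gp, hg, hgp, hPg⟩ := hPp
  have hle : ∀ᶠ p in (F : Filter Nat.Primes), ∀ j, χ p (gp j p) = 0 := by
    refine eventually_all.2 fun j => (ulim_eq_zero_iff F).1 ?_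
    rw [← ulimMap_ulim, hgp]
    exact hηP _ (hg ▸ Ideal.subset_span ⟨j, rfl⟩)
  filter_upwards [hle, hPg, hhY, hqY, hsY, hdom, hχX] with p h1 h2 h3 h4 h5 h6 h7
  have hker : Pp p = RingHom.ker (χ p) := by
    refine le_antisymm ?_ fun a ha => ?_
    · rw [h2, Ideal.span_le]
      rintro _ ⟨j, rfl⟩
      exact h1 j
    -- For `a` in the kernel, `hp p` divides `G`, hence `G (Y) ∈ Pp p`. So a power of `s (Y)` times
    -- `a` lies in `Pp p`, and `h5` cancels the power.
    · obtain ⟨N, G, h8, h9⟩ := exists_pow_mul_sub_mem h4 (χ p) (χ' p) (hχC p) h7 a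
      rw [(RingHom.mem_ker).1 ha, mul_zero, eq_comm, hχ'] at h9
      have hG : aeval (fun i => Yp i p) G ∈ Pp p := by
        obtain ⟨c, rfl⟩ := h9
        rw [map_mul]
        exact Ideal.mul_mem_right _ _ h3
      have h10 : aeval (fun i => Yp i p) (sp p) ^ N * a ∈ Pp p := by
        simpa using add_mem h8 hG
      clear h8
      induction N with
      | zero => simpa using h10
      | succ N ih => exact ih (h5 _ (by rwa [pow_succ', mul_assoc] at h10))
  rw [hker]
  exact RingHom.ker_isPrime _

/-- Approximations of a prime ideal are almost always prime. -/
theorem eventually_isPrime {P : Ideal (MvPolynomial (Fin n) ℂ)} [hP : P.IsPrime]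
    {Pp : ∀ p, Ideal (MvPolynomial (Fin n) (FpBar p))}
    (hPp : IsIdealApprox (polyHull F α n) P Pp) :
    ∀ᶠ p in (F : Filter Nat.Primes), (Pp p).IsPrime := by
  obtain ⟨d, Y, h, s, q, hirr, hdvd, hs, hq⟩ := exists_hypersurface P
  obtain ⟨Yp, hYp⟩ := exists_ulim_eq F fun i => polyHull F α n (Y i)
  obtain ⟨hp, hhp⟩ := Ideal.Quotient.mk_surjective (polyHull F α d h)
  obtain ⟨sp, hsp⟩ := Ideal.Quotient.mk_surjective (polyHull F α d s)
  obtain ⟨qp, hqp⟩ := exists_ulim_eq F fun i => polyHull F α d (q i)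
  have hhY : ∀ᶠ p in (F : Filter Nat.Primes), aeval (fun i => Yp i p) (hp p) ∈ Pp p := by
    refine hPp.ulim_mem_map_iff.1 ?_
    rw [ulim_aeval hYp hhp]
    exact Ideal.mem_map_of_mem _ ((hdvd h).2 dvd_rfl)
  have hqY : ∀ᶠ p in (F : Filter Nat.Primes), ∀ i, aeval (fun i => Yp i p) (sp p) * X i -
      aeval (fun i => Yp i p) (qp i p) ∈ Pp p := by
    refine eventually_all.2 fun i => hPp.ulim_mem_map_iff.1 ?_
    have : (fun p => aeval (fun i => Yp i p) (sp p) * X i - aeval (fun i => Yp i p) (qp i p)) =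
        (fun p => aeval (fun i => Yp i p) (sp p)) * (fun _ => X i) -
          fun p => aeval (fun i => Yp i p) (qp i p) := rfl
    rw [this, map_sub, map_mul, ulim_aeval hYp hsp, ulim_aeval hYp (hqp i),
      ← polyHull_X (α := α), ← map_mul, ← map_sub]
    exact Ideal.mem_map_of_mem _ (hq i)
  have hirrp := eventually_irreducible hirr hhp
  have hsdvd := eventually_not_dvd hs hhp hsp
  have hsY : ∀ᶠ p in (F : Filter Nat.Primes), ∀ a, aeval (fun i => Yp i p) (sp p) * a ∈ Pp p →
      a ∈ Pp p := by
    -- Counterexamples `a p` for almost all `p` would form an element of the hull contradicting that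
    -- `s (Y)` is a nonzerodivisor modulo the extension of `P`, which is where flatness enters.
    by_contra hcon
    rw [← Ultrafilter.eventually_not] at hcon
    have hex : ∀ p, ∃ a, ¬ (∀ a, aeval (fun i => Yp i p) (sp p) * a ∈ Pp p → a ∈ Pp p) →
        aeval (fun i => Yp i p) (sp p) * a ∈ Pp p ∧ a ∉ Pp p := by
      intro p
      by_cases hp : ∀ a, aeval (fun i => Yp i p) (sp p) * a ∈ Pp p → a ∈ Pp p
      · exact ⟨0, fun h => absurd hp h⟩
      · push Not at hp
        exact ⟨hp.choose, fun _ => hp.choose_spec⟩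
    choose a ha using hex
    have h1 : ulim F a ∈ P.map (polyHull F α n) := by
      refine (polyHull_flat F α n).mem_map_of_mul_mem (IsNoetherian.noetherian P)
        (s := aeval Y s) (fun hmem => hs ((hdvd s).1 hmem)) ?_
      rw [← ulim_aeval hYp hsp, ← map_mul, hPp.ulim_mem_map_iff]
      filter_upwards [hcon] with p h2 using (ha p h2).1
    obtain ⟨p, h2, h3⟩ := ((hPp.ulim_mem_map_iff.1 h1).and hcon).exists
    exact (ha p h3).2 h2
  let E : Nat.Primes → Type := fun p =>
    FractionRing (MvPolynomial (Fin d) (FpBar p) ⧸ Ideal.span {hp p})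
  let χ' : ∀ p, MvPolynomial (Fin d) (FpBar p) →+* E p := fun p =>
    (algebraMap (MvPolynomial (Fin d) (FpBar p) ⧸ Ideal.span {hp p}) (E p)).comp
      (Ideal.Quotient.mk _)
  -- This holds even if `hp p` is reducible: localization at the nonzerodivisors is injective for
  -- any ring.
  have hχ' : ∀ p g, χ' p g = 0 ↔ hp p ∣ g := by
    intro p g
    rw [← Ideal.mem_span_singleton, ← Ideal.Quotient.eq_zero_iff_mem]
    exact map_eq_zero_iff _ (IsFractionRing.injective
      (MvPolynomial (Fin d) (FpBar p) ⧸ Ideal.span {hp p}) (E p))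
  have hdom : ∀ᶠ p in (F : Filter Nat.Primes),
      IsDomain (MvPolynomial (Fin d) (FpBar p) ⧸ Ideal.span {hp p}) := by
    filter_upwards [hirrp] with p h1
    rw [Ideal.Quotient.isDomain_iff_prime, Ideal.span_singleton_prime h1.ne_zero]
    exact h1.prime
  have hunit : ∀ᶠ p in (F : Filter Nat.Primes), IsUnit (χ' p (sp p)) := by
    filter_upwards [hdom, hsdvd] with p h1 h2
    refine IsLocalization.map_units (E p)
      (⟨Ideal.Quotient.mk _ (sp p), mem_nonZeroDivisors_of_ne_zero fun h0 => h2 ?_⟩ :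
      nonZeroDivisors (MvPolynomial (Fin d) (FpBar p) ⧸ Ideal.span {hp p}))
    rwa [Ideal.Quotient.eq_zero_iff_mem, Ideal.mem_span_singleton] at h0
  refine eventually_isPrime_of_birational hPp (fun g => (hdvd g).1) hq hhp hsp hqp hhY hqY hsY
    χ' hχ' ?_ hunit
  filter_upwards [hdom] with p h1
  exact IsFractionRing.isDomain (MvPolynomial (Fin d) (FpBar p) ⧸ Ideal.span {hp p})

end Prime

/-! ## Purity of the canonical homomorphism to the non-standard hull -/

/-- Solutions of a finite system of linear equations in a flat algebra are combinations of
solutions in the base. -/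
theorem RingHom.Flat.mem_span_of_system {A : Type u} {B : Type v} [CommRing A] [CommRing B]
    {φ : A →+* B} (hφ : φ.Flat) {ι τ : Type} [Fintype ι] [Fintype τ] (f : ι → τ → A) (x : τ → B)
    (hx : ∀ i, ∑ j, φ (f i j) * x j = 0) :
    x ∈ Submodule.span B {s : τ → B | ∃ t : τ → A, (∀ i, ∑ j, f i j * t j = 0) ∧ s = φ ∘ t} := by
  classical
  let _ : Algebra A B := φ.toAlgebra
  have : Module.Flat A B := hφ
  have hsingle : ∀ i, ∑ j, f i j • Pi.single j (1 : A) = f i := fun i => by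
    ext l; simp [Finset.sum_apply, Pi.single_apply]
  obtain ⟨k, a, y, h1, h2⟩ := Module.Flat.exists_factorization_of_comp_eq_zero_of_free
    (R := A) (M := B) (f := Fintype.linearCombination A f) (x := Fintype.linearCombination A x) (by
      ext i
      simp only [LinearMap.comp_apply, LinearMap.single_apply,
        Fintype.linearCombination_apply_single, one_smul, LinearMap.zero_apply]
      simp only [Fintype.linearCombination_apply, Algebra.smul_def]
      exact hx i)
  have hxt : x = ∑ κ, y (Finsupp.single κ 1) • (fun j => φ (a (Pi.single j 1) κ)) := by
    ext j
    have h3 := LinearMap.congr_fun h1 (Pi.single j 1)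
    simp only [Fintype.linearCombination_apply_single, one_smul, LinearMap.comp_apply] at h3
    rw [h3]
    conv_lhs => rw [← Finsupp.univ_sum_single (a (Pi.single j 1)), map_sum]
    rw [Finset.sum_apply]
    refine Finset.sum_congr rfl fun κ _ => ?_
    rw [← mul_one (a (Pi.single j 1) κ), ← smul_eq_mul, ← Finsupp.smul_single, map_smul,
      Algebra.smul_def, mul_comm]
    simp
    rfl
  rw [hxt]
  refine Submodule.sum_mem _ fun κ _ => Submodule.smul_mem _ _
    (Submodule.subset_span ⟨fun j => a (Pi.single j 1) κ, fun i => ?_, rfl⟩)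
  have h4 := DFunLike.congr_fun (LinearMap.congr_fun h2 (Pi.single i 1)) κ
  simp only [LinearMap.comp_apply, Fintype.linearCombination_apply_single, one_smul,
    LinearMap.zero_apply, Finsupp.coe_zero, Pi.zero_apply] at h4
  rw [← hsingle i, map_sum, Finsupp.finsetSum_apply] at h4
  simpa using h4

namespace LocalApprox

variable {F : Ultrafilter Nat.Primes} {α : Ulim F FpBar ≃+* ℂ} {R : Type u} [CommRing R]
  [IsLocalRing R] [Algebra ℂ R] (X : LocalApprox F α R)

theorem eventually_isPrime : ∀ᶠ p in (F : Filter Nat.Primes), (X.P p).IsPrime := by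
  have : ((IsLocalRing.maximalIdeal R).comap (MvPolynomial.aeval (R := ℂ) X.x)).IsPrime :=
    Ideal.IsPrime.comap _
  exact _root_.eventually_isPrime X.approx_P

theorem eventually_I_le_P : ∀ᶠ p in (F : Filter Nat.Primes), X.I p ≤ X.P p := by
  obtain ⟨m, g, gp, hg, hgp, hI⟩ := X.approx_I
  have h1 : ∀ᶠ p in (F : Filter Nat.Primes), ∀ j, gp j p ∈ X.P p := by
    refine eventually_all.2 fun j => X.approx_P.ulim_mem_map_iff.1 ?_
    rw [hgp]
    refine Ideal.mem_map_of_mem _ ?_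
    have h2 : g j ∈ RingHom.ker (MvPolynomial.aeval (R := ℂ) X.x) :=
      hg ▸ Ideal.subset_span ⟨j, rfl⟩
    rw [Ideal.mem_comap, (RingHom.mem_ker).1 h2]
    exact zero_mem _
  filter_upwards [h1, hI] with p h2 h3
  rw [h3, Ideal.span_le]
  rintro _ ⟨j, rfl⟩
  exact h2 j

/-- The members of an approximation are almost always local rings. -/
theorem eventually_isLocalRing :
    ∀ᶠ p in (F : Filter Nat.Primes), IsLocalRing (X.ring p) := by
  filter_upwards [X.eventually_isPrime, X.eventually_I_le_P] with p hp hle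
  have hsurj := Ideal.Quotient.mk_surjective (I := X.I p)
  have hker : RingHom.ker (Ideal.Quotient.mk (X.I p)) ≤ X.P p := by rwa [Ideal.mk_ker]
  let Q := (X.P p).map (Ideal.Quotient.mk (X.I p))
  have hQ : Q.IsPrime := Ideal.map_isPrime_of_surjective hsurj hker
  have hcomap : ∀ g, Ideal.Quotient.mk (X.I p) g ∈ Q ↔ g ∈ X.P p := by
    intro g
    rw [← Ideal.mem_comap, Ideal.comap_map_of_surjective' _ hsurj, sup_eq_left.2 hker]
  -- Since `I_p ⊆ P_p`, the complement of `P_p` maps onto the complement of `P_p / I_p`.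
  have hM : (X.denom p).map (Ideal.Quotient.mk (X.I p)) = Q.primeCompl := by
    rw [X.denom_eq p hp]
    ext y
    obtain ⟨g, rfl⟩ := hsurj y
    constructor
    · rintro ⟨g', hg', hgg⟩
      rw [← hgg]
      exact fun h => hg' ((hcomap g').1 h)
    · exact fun h => ⟨g, fun hg => h ((hcomap g).2 hg), rfl⟩
  have : IsLocalization.AtPrime (Localization ((X.denom p).map (Ideal.Quotient.mk (X.I p)))) Q := by
    unfold IsLocalization.AtPrime
    rw [← hM]
    infer_instance
  exact IsLocalization.AtPrime.isLocalRing
    (Localization ((X.denom p).map (Ideal.Quotient.mk (X.I p)))) Q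

theorem toRing_eq_zero_iff (p : Nat.Primes) (g : MvPolynomial (Fin X.n) (FpBar p)) :
    X.toRing p g = 0 ↔ ∃ d ∈ X.denom p, d * g ∈ X.I p := by
  change algebraMap _ (Localization ((X.denom p).map (Ideal.Quotient.mk (X.I p))))
    (Ideal.Quotient.mk (X.I p) g) = 0 ↔ _
  rw [IsLocalization.map_eq_zero_iff ((X.denom p).map (Ideal.Quotient.mk (X.I p)))]
  constructor
  · rintro ⟨⟨_, d, hd, rfl⟩, h⟩
    exact ⟨d, hd, by rwa [← Ideal.Quotient.eq_zero_iff_mem, map_mul]⟩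
  · rintro ⟨d, hd, h⟩
    exact ⟨⟨_, d, hd, rfl⟩, by rwa [← Ideal.Quotient.eq_zero_iff_mem, map_mul] at h⟩

theorem exists_toRing_mul_eq (p : Nat.Primes) {ι : Type*} [Finite ι] (w : ι → X.ring p) :
    ∃ d ∈ X.denom p, ∃ b : ι → MvPolynomial (Fin X.n) (FpBar p),
      ∀ j, X.toRing p d * w j = X.toRing p (b j) := by
  have key : ∀ w : ι → Localization ((X.denom p).map (Ideal.Quotient.mk (X.I p))),
      ∃ d ∈ X.denom p, ∃ b : ι → MvPolynomial (Fin X.n) (FpBar p), ∀ j,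
        algebraMap (MvPolynomial (Fin X.n) (FpBar p) ⧸ X.I p)
          (Localization ((X.denom p).map (Ideal.Quotient.mk (X.I p))))
            (Ideal.Quotient.mk _ d) * w j =
        algebraMap (MvPolynomial (Fin X.n) (FpBar p) ⧸ X.I p)
          (Localization ((X.denom p).map (Ideal.Quotient.mk (X.I p))))
            (Ideal.Quotient.mk _ (b j)) := by
    intro w
    obtain ⟨⟨_, d, hd, rfl⟩, h⟩ := IsLocalization.exist_integer_multiples_of_finite
      ((X.denom p).map (Ideal.Quotient.mk (X.I p))) w
    choose y hy using h
    choose b hb using fun j => Ideal.Quotient.mk_surjective (y j)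
    refine ⟨d, hd, b, fun j => ?_⟩
    rw [hb, hy, Algebra.smul_def]
  exact key w

theorem exists_common_denominator {ι : Type*} [Fintype ι] (r : ι → R) :
    ∃ s : MvPolynomial (Fin X.n) ℂ, IsUnit (MvPolynomial.aeval X.x s) ∧
      ∃ f : ι → MvPolynomial (Fin X.n) ℂ,
        ∀ i, r i * MvPolynomial.aeval X.x s = MvPolynomial.aeval X.x (f i) := by
  classical
  choose f s hs hf using fun i => X.frac (r i)
  refine ⟨∏ i, s i, ?_, fun i => f i * ∏ j ∈ Finset.univ.erase i, s j, fun i => ?_⟩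
  · rw [map_prod]
    exact IsUnit.prod_univ_iff.2 hs
  · rw [← Finset.mul_prod_erase _ _ (Finset.mem_univ i), map_mul, map_mul, ← hf, mul_assoc]

/-- A linear system over `R_∞` with standard coefficients has, after clearing denominators and
lifting, a solution over the hull of the polynomial ring. -/
theorem exists_lift_solution {m k l : ℕ} {f : Fin m → MvPolynomial (Fin X.n) ℂ}
    {g : Fin m → Fin k → MvPolynomial (Fin X.n) ℂ} {h : Fin l → MvPolynomial (Fin X.n) ℂ}
    (hh : Ideal.span (Set.range h) = RingHom.ker (MvPolynomial.aeval (R := ℂ) X.x))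
    {w : Fin k → Ulim F X.ring}
    (hw : ∀ i, X.polyToHull (f i) = ∑ j, X.polyToHull (g i j) * w j) :
    ∃ (d : ∀ p, MvPolynomial (Fin X.n) (FpBar p))
      (b : Fin k → Ulim F fun p => MvPolynomial (Fin X.n) (FpBar p))
      (c : Fin m → Fin l → Ulim F fun p => MvPolynomial (Fin X.n) (FpBar p)),
      (∀ᶠ p in (F : Filter Nat.Primes), d p ∈ X.denom p) ∧
      ∀ i, polyHull F α X.n (f i) * ulim F d = ∑ j, polyHull F α X.n (g i j) * b j +
        ∑ j, polyHull F α X.n (h j) * c i j := by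
  obtain ⟨fp, hfp⟩ := exists_ulim_eq F fun i => polyHull F α X.n (f i)
  obtain ⟨gp, hgp⟩ := exists_ulim_eq F fun ij : Fin m × Fin k => polyHull F α X.n (g ij.1 ij.2)
  obtain ⟨hp, hhp⟩ := exists_ulim_eq F fun j => polyHull F α X.n (h j)
  obtain ⟨wp, hwp⟩ := exists_ulim_eq F w
  have hI := X.approx_I.eventually_eq_span hh hhp
  have hweq : ∀ᶠ p in (F : Filter Nat.Primes), ∀ i,
      X.toRing p (fp i p) = ∑ j, X.toRing p (gp (i, j) p) * wp j p := by
    refine eventually_all.2 fun i => (ulim_eq_iff F).1 ?_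
    have h1 : (fun p => ∑ j, X.toRing p (gp (i, j) p) * wp j p) =
        ∑ j, (fun p => X.toRing p (gp (i, j) p)) * wp j := by
      ext1 p; simp [Finset.sum_apply]
    have h2 := hw i
    simp only [polyToHull, RingHom.comp_apply, ← hfp, fun j => (hgp (i, j)).symm, ← hwp,
      ulimMap_ulim] at h2
    rw [h1, map_sum, h2]
    simp only [map_mul]
  have hex : ∀ p, ∃ (d : MvPolynomial (Fin X.n) (FpBar p))
      (b : Fin k → MvPolynomial (Fin X.n) (FpBar p))
      (c : Fin m → Fin l → MvPolynomial (Fin X.n) (FpBar p)),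
      (∀ i, X.toRing p (fp i p) = ∑ j, X.toRing p (gp (i, j) p) * wp j p) →
      X.I p = Ideal.span (Set.range fun j => hp j p) → d ∈ X.denom p ∧
      ∀ i, fp i p * d = ∑ j, gp (i, j) p * b j + ∑ j, hp j p * c i j := by
    intro p
    by_cases hcase : (∀ i, X.toRing p (fp i p) = ∑ j, X.toRing p (gp (i, j) p) * wp j p) ∧
      X.I p = Ideal.span (Set.range fun j => hp j p)
    swap
    · exact ⟨0, 0, 0, fun h1 h2 => absurd ⟨h1, h2⟩ hcase⟩
    obtain ⟨h1, h2⟩ := hcase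
    obtain ⟨d, hd, b, hb⟩ := X.exists_toRing_mul_eq p fun j => wp j p
    -- After writing the solution with common denominator `d`, equation `i` holds in the polynomial
    -- ring modulo `I_p` once multiplied by some `e i`. The final denominator is `d` times the
    -- product of all `e i`.
    have h3 : ∀ i, ∃ e ∈ X.denom p, e * (fp i p * d - ∑ j, gp (i, j) p * b j) ∈ X.I p := by
      intro i
      rw [← toRing_eq_zero_iff, map_sub, map_mul, h1, map_sum, Finset.sum_mul, sub_eq_zero]
      refine Finset.sum_congr rfl fun j _ => ?_
      rw [map_mul, ← hb]
      ring
    choose e he hei using h3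
    have h4 : ∀ i, ∃ c : Fin l → MvPolynomial (Fin X.n) (FpBar p), ∑ j, c j * hp j p =
        (∏ i, e i) * (fp i p * d - ∑ j, gp (i, j) p * b j) := by
      intro i
      rw [← Ideal.mem_span_range_iff_exists_fun, ← h2, ← Finset.prod_erase_mul _ _
        (Finset.mem_univ i), mul_assoc]
      exact Ideal.mul_mem_left _ _ (hei i)
    choose c hc using h4
    refine ⟨d * ∏ i, e i, fun j => b j * ∏ i, e i, c, fun _ _ =>
      ⟨mul_mem hd (prod_mem fun i _ => he i), fun i => ?_⟩⟩
    simp only [mul_comm (hp _ p), hc, ← mul_assoc, ← Finset.sum_mul]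
    ring
  choose d b c hdbc using hex
  refine ⟨d, fun j => ulim F fun p => b p j, fun i j => ulim F fun p => c p i j, ?_, fun i => ?_⟩
  · filter_upwards [hweq, hI] with p h1 h2 using (hdbc p h1 h2).1
  · rw [← hfp, ← map_mul]
    simp only [← hhp, fun j => (hgp (i, j)).symm, ← map_mul]
    rw [← map_sum, ← map_sum, ← map_add, ulim_eq_iff]
    filter_upwards [hweq, hI] with p h1 h2
    simpa [Finset.sum_apply] using (hdbc p h1 h2).2 i

/-- The canonical homomorphism from `R` to its non-standard hull is pure. -/
theorem isPureRingHom_toHull : IsPureRingHom X.toHull := by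
  rw [IsPureRingHom, isPureTwist_iff]
  intro m k a v w hw
  obtain ⟨s, hs, r, hr⟩ := X.exists_common_denominator
    (Sum.elim v fun ij : Fin m × Fin k => a ij.1 ij.2)
  obtain ⟨l, h, -, hh, -, -⟩ := X.approx_I
  have hv : ∀ i, v i * MvPolynomial.aeval X.x s = MvPolynomial.aeval X.x (r (Sum.inl i)) :=
    fun i => hr (Sum.inl i)
  have ha : ∀ i j, a i j * MvPolynomial.aeval X.x s =
      MvPolynomial.aeval X.x (r (Sum.inr (i, j))) := fun i j => hr (Sum.inr (i, j))
  obtain ⟨d, b, c, hd, hsol⟩ := X.exists_lift_solution (f := fun i => r (Sum.inl i))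
    (g := fun i j => r (Sum.inr (i, j))) hh (w := w) (fun i => by
      simp only [← toHull_aeval, ← hv, ← ha, map_mul]
      have := hw i
      rw [mul_one] at this
      rw [this, Finset.sum_mul]
      exact Finset.sum_congr rfl fun j _ => by ring)
  set P := (IsLocalRing.maximalIdeal R).comap (MvPolynomial.aeval (R := ℂ) X.x) with hP
  -- The homogeneous system over the polynomial ring. Its unknowns are the denominator (`none`), the
  -- numerators of the solution (`inl`), and for each equation the coefficients on the generators
  -- `h` of the kernel (`inr`).
  let row : Fin m → Option (Fin k ⊕ (Fin m × Fin l)) → MvPolynomial (Fin X.n) ℂ := fun i τ =>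
    τ.elim (-r (Sum.inl i)) (Sum.elim (fun j => r (Sum.inr (i, j)))
      fun ij => if ij.1 = i then h ij.2 else 0)
  let x : Option (Fin k ⊕ (Fin m × Fin l)) → Ulim F fun p => MvPolynomial (Fin X.n) (FpBar p) :=
    fun τ => τ.elim (ulim F d) (Sum.elim b fun ij => c ij.1 ij.2)
  have hrow : ∀ {B : Type} [CommRing B] (φ : MvPolynomial (Fin X.n) ℂ →+* B)
      (y : Option (Fin k ⊕ (Fin m × Fin l)) → B) (i : Fin m), ∑ τ, φ (row i τ) * y τ =
        -(φ (r (Sum.inl i)) * y none) + (∑ j, φ (r (Sum.inr (i, j))) * y (some (Sum.inl j)) +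
          ∑ j, φ (h j) * y (some (Sum.inr (i, j)))) := by
    intro B _ φ y i
    rw [Fintype.sum_option, Fintype.sum_sum_type, Fintype.sum_prod_type]
    simp only [row, Option.elim, Sum.elim_inl, Sum.elim_inr, map_neg, neg_mul]
    congr 2
    rw [Finset.sum_eq_single i (fun i' _ hi' => by simp [hi']) (by simp)]
    simp
  have hmem := (polyHull_flat F α X.n).mem_span_of_system row x (fun i => by
    rw [hrow]
    simp only [x, Option.elim, Sum.elim_inl, Sum.elim_inr]
    rw [hsol, neg_add_cancel])
  -- Were the `none` coordinate of every standard solution in `P`, flatness would put `ulim F d` in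
  -- the extension of `P`, hence `d p` in `P_p`. But `d p` is a denominator and `P_p` is almost
  -- always prime.
  obtain ⟨t, ht, htP⟩ : ∃ t : Option (Fin k ⊕ (Fin m × Fin l)) → MvPolynomial (Fin X.n) ℂ,
      (∀ i, ∑ τ, row i τ * t τ = 0) ∧ t none ∉ P := by
    by_contra! hcon
    have hle : Submodule.span _ {s : Option (Fin k ⊕ (Fin m × Fin l)) → _ |
        ∃ t : Option (Fin k ⊕ (Fin m × Fin l)) → MvPolynomial (Fin X.n) ℂ,
          (∀ i, ∑ τ, row i τ * t τ = 0) ∧ s = polyHull F α X.n ∘ t} ≤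
        Submodule.comap (LinearMap.proj none) (P.map (polyHull F α X.n)) := by
      rw [Submodule.span_le]
      rintro _ ⟨t, ht, rfl⟩
      exact Ideal.mem_map_of_mem (polyHull F α X.n) (hcon t ht)
    have hdP : ulim F d ∈ P.map (polyHull F α X.n) := hle hmem
    obtain ⟨p, h1, h2, h3⟩ := ((X.approx_P.ulim_mem_map_iff.1 hdP).and
      (hd.and X.eventually_isPrime)).exists
    rw [X.denom_eq p h3] at h2
    exact h2 h1
  have hu : IsUnit (MvPolynomial.aeval X.x (t none)) := by
    by_contra hu
    exact htP ((IsLocalRing.mem_maximalIdeal _).2 hu)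
  obtain ⟨u, hu⟩ := hu
  refine ⟨fun j => MvPolynomial.aeval X.x (t (some (Sum.inl j))) * ↑u⁻¹, fun i => ?_⟩
  have h0 : ∀ j, MvPolynomial.aeval X.x (h j) = 0 := fun j => by
    have : h j ∈ RingHom.ker (MvPolynomial.aeval (R := ℂ) X.x) := hh ▸ Ideal.subset_span ⟨j, rfl⟩
    exact (RingHom.mem_ker).1 this
  have h1 := hrow (RingHom.id _) t i
  simp only [RingHom.id_apply] at h1
  -- In `R` the generators `h j` vanish and `t none` becomes a unit, so dividing by it gives the
  -- solution.
  rw [ht, eq_comm, neg_add_eq_zero] at h1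
  have h2 := congrArg (MvPolynomial.aeval X.x) h1
  simp only [map_mul, map_add, map_sum, h0, zero_mul, Finset.sum_const_zero, add_zero, ← hv,
    ← ha, ← hu] at h2
  refine hs.mul_right_cancel ((Units.mul_left_inj u).1 ?_)
  rw [h2, Finset.sum_mul, Finset.sum_mul]
  refine Finset.sum_congr rfl fun j _ => ?_
  calc _ = a i j * MvPolynomial.aeval X.x s * MvPolynomial.aeval X.x (t (some (Sum.inl j))) *
        (↑u⁻¹ * ↑u) := by rw [Units.inv_mul, mul_one]
    _ = _ := by ring

end LocalApprox

/-! ## Descent of sharp `F`-purity to the non-standard hull -/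

section Germs

variable {F : Ultrafilter Nat.Primes}

theorem germ_coe_sum {ι : Type*} (s : Finset ι) (μ : ι → Nat.Primes → ℕ) :
    ∑ i ∈ s, ((μ i : HyperNat F)) = ((fun p => ∑ i ∈ s, μ i p : Nat.Primes → ℕ) : HyperNat F) := by
  have h : (fun p => ∑ i ∈ s, μ i p) = ∑ i ∈ s, μ i := by
    ext1 p
    simp [Finset.sum_apply]
  rw [h]
  exact (map_sum (Germ.coeAddHom (F : Filter Nat.Primes) (M := ℕ)) μ s).symm

theorem hyperExponent_coe (t : ℝ) (e : Nat.Primes → ℕ) :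
    hyperExponent F t (e : HyperNat F) =
      ((fun p => ⌈t * (((p : ℕ) : ℝ) ^ e p - 1)⌉₊ : Nat.Primes → ℕ) : HyperNat F) := by
  have h : (fun p : Nat.Primes => ⌈t * (((p : ℕ) : ℝ) ^ e p - 1)⌉₊) =
      fun p : Nat.Primes => ⌈t * ((((p : ℕ) ^ e p : ℕ) : ℝ) - 1)⌉₊ := by
    ext1 p
    rw [Nat.cast_pow]
  rw [h]
  rfl

theorem prod_hyperPow {A : Nat.Primes → Type u} [∀ p, CommRing (A p)] {ι : Type*} (s : Finset ι)
    (x : ι → ∀ p, A p) (μ : ι → Nat.Primes → ℕ) :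
    ∏ i ∈ s, hyperPow (ulim F (x i)) (μ i : HyperNat F) =
      ulim F fun p => ∏ i ∈ s, x i p ^ μ i p := by
  have h : (fun p => ∏ i ∈ s, x i p ^ μ i p) = ∏ i ∈ s, fun p => x i p ^ μ i p := by
    ext1 p
    simp [Finset.prod_apply]
  simp only [hyperPow_ulim]
  rw [h, map_prod]

end Germs

namespace LocalApprox

variable {F : Ultrafilter Nat.Primes} {α : Ulim F FpBar ≃+* ℂ} {R : Type u} [CommRing R]
  [IsLocalRing R] [Algebra ℂ R] {X : LocalApprox F α R}

theorem frob_apply {e : Nat.Primes → ℕ} {x : ∀ p, X.ring p} {r : R}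
    (h : ulim F x = X.toHull r) :
    X.frob (e : HyperNat F) r = ulim F fun p => x p ^ (p : ℕ) ^ e p := by
  change ultraFrob (e : HyperNat F) (X.toHull r) = _
  rw [← h]
  rfl

/-- Purity of almost all maps `S_p → F^e_* S_p`, `x ↦ φ_p (c_p) x ^ (p ^ e)`, descends to purity
of `c F^ε` on `R` along a pure homomorphism `R → S`. -/
theorem isPureTwist_frob_of_eventually {S : Type v} [CommRing S] [IsLocalRing S] [Algebra ℂ S]
    {Y : LocalApprox F α S} {φ : R →+* S} {φp : ∀ p, X.ring p → Y.ring p}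
    (hφ : IsPureRingHom φ) (hφp : X.IsHomApprox Y φ φp) {e : Nat.Primes → ℕ}
    {c : ∀ p, X.ring p} (hc : ∀ᶠ p : Nat.Primes in (F : Filter Nat.Primes),
      IsPureTwist (frobPow (p : ℕ) (Y.ring p) (e p)) (φp p (c p))) :
    IsPureTwist (X.frob (e : HyperNat F)) (ulim F c) := by
  rw [isPureTwist_iff]
  intro m k a v w hw
  obtain ⟨vp, hvp⟩ := exists_ulim_eq F fun i => X.toHull (v i)
  obtain ⟨ap, hap⟩ := exists_ulim_eq F fun ij : Fin m × Fin k => X.toHull (a ij.1 ij.2)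
  obtain ⟨wp, hwp⟩ := exists_ulim_eq F w
  have hsol : ∀ᶠ p : Nat.Primes in (F : Filter Nat.Primes), ∀ i,
      vp i p ^ (p : ℕ) ^ e p * c p = ∑ j, ap (i, j) p ^ (p : ℕ) ^ e p * wp j p := by
    refine eventually_all.2 fun i => (ulim_eq_iff F).1 ?_
    have h1 : (fun p : Nat.Primes => ∑ j, ap (i, j) p ^ (p : ℕ) ^ e p * wp j p) =
        ∑ j, (fun p => ap (i, j) p ^ (p : ℕ) ^ e p) * wp j := by
      ext1 p; simp [Finset.sum_apply]
    have h2 := hw i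
    have h3 : ∀ j, X.frob (e : HyperNat F) (a i j) = _ := fun j => frob_apply (hap (i, j))
    simp only [frob_apply (hvp i), h3, ← hwp, ← map_mul] at h2
    rw [h1, map_sum]
    exact h2
  have hex : ∀ p, ∃ y : Fin k → Y.ring p,
      (∃ ψ : X.ring p →ₐ[FpBar p] Y.ring p, φp p = ψ) →
      IsPureTwist (frobPow (p : ℕ) (Y.ring p) (e p)) (φp p (c p)) →
      (∀ i, vp i p ^ (p : ℕ) ^ e p * c p = ∑ j, ap (i, j) p ^ (p : ℕ) ^ e p * wp j p) →
      ∀ i, φp p (vp i p) = ∑ j, φp p (ap (i, j) p) * y j := by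
    intro p
    by_cases h : (∃ ψ : X.ring p →ₐ[FpBar p] Y.ring p, φp p = ψ) ∧
      IsPureTwist (frobPow (p : ℕ) (Y.ring p) (e p)) (φp p (c p)) ∧
      ∀ i, vp i p ^ (p : ℕ) ^ e p * c p = ∑ j, ap (i, j) p ^ (p : ℕ) ^ e p * wp j p
    swap
    · exact ⟨0, fun h1 h2 h3 => absurd ⟨h1, h2, h3⟩ h⟩
    obtain ⟨⟨ψ, hψ⟩, h2, h3⟩ := h
    rw [isPureTwist_iff] at h2
    -- `φ_p` carries the twisted system to `S_p`, where purity yields a solution of the untwisted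
    -- one.
    obtain ⟨y, hy⟩ := h2 m k (fun i j => φp p (ap (i, j) p)) (fun i => φp p (vp i p))
      (fun j => φp p (wp j p)) (fun i => by
        change φp p (vp i p) ^ (p : ℕ) ^ e p * _ =
          ∑ j, φp p (ap (i, j) p) ^ (p : ℕ) ^ e p * φp p (wp j p)
        have h4 := congrArg ψ (h3 i)
        simpa only [hψ, map_mul, map_sum, map_pow] using h4)
    exact ⟨y, fun _ _ _ => hy⟩
  choose y hy using hex
  have hS : ∀ i, Y.toHull (φ (v i)) =
      ∑ j, Y.toHull (φ (a i j)) * ulim F fun p => y p j := by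
    intro i
    have h1 : (fun p => ∑ j, φp p (ap (i, j) p) * y p j) =
        ∑ j, (fun p => φp p (ap (i, j) p)) * fun p => y p j := by
      ext1 p; simp [Finset.sum_apply]
    rw [← hφp.2 _ _ (hvp i)]
    simp only [← hφp.2 _ _ (hap (i, _)), ← map_mul]
    rw [← map_sum, ← h1, ulim_eq_iff]
    filter_upwards [hφp.1, hc, hsol] with p h2 h3 h4 using hy p h2 h3 h4 i
  -- The solution over `S_∞` descends first to `S`, then along `φ` to `R`.
  obtain ⟨z, hz⟩ := (isPureTwist_iff _ _).1 Y.isPureRingHom_toHull m k (fun i j => φ (a i j))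
    (fun i => φ (v i)) (fun j => ulim F fun p => y p j) (fun i => by rw [mul_one]; exact hS i)
  exact (isPureTwist_iff _ _).1 hφ m k a v z fun i => by rw [mul_one]; exact hz i

/-- If almost all pairs `(S_p, (𝔞_p S_p)^t)` are sharply `F`-pure and `R → S` is pure, then there
are monomials `f` in given generators of `𝔞`, of degree `⌈t (π ^ ε - 1)⌉` with `ε` arbitrarily
large, such that `f F^ε` is pure. -/
theorem exists_pure_monomial {S : Type v} [CommRing S] [IsLocalRing S] [Algebra ℂ S]
    {Y : LocalApprox F α S} {φ : R →+* S} {φp : ∀ p, X.ring p → Y.ring p}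
    (hφ : IsPureRingHom φ) (hφp : X.IsHomApprox Y φ φp) {a : Ideal R}
    {ap : ∀ p, Ideal (X.ring p)} (hap : IsIdealApprox X.toHull a ap) {t : ℝ}
    (hS : ∀ᶠ p : Nat.Primes in (F : Filter Nat.Primes), IsSharplyFPure (p : ℕ) (Y.ring p)
      (Ideal.span (φp p '' (ap p : Set (X.ring p)))) t)
    {n : ℕ} {f : Fin n → R} (hf : Ideal.span (Set.range f) = a) (ε₀ : HyperNat F) :
    ∃ ε : HyperNat F, ε₀ ≤ ε ∧ ∃ μ : Fin n → HyperNat F, ∑ i, μ i = hyperExponent F t ε ∧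
      IsPureTwist (X.frob ε) (∏ i, hyperPow (X.toHull (f i)) (μ i)) := by
  induction ε₀ using Germ.inductionOn with | _ e₀ =>
  obtain ⟨fp, hfp⟩ := exists_ulim_eq F fun i => X.toHull (f i)
  have hex : ∀ᶠ p : Nat.Primes in (F : Filter Nat.Primes), ∃ e : ℕ, ∃ μ : Fin n → ℕ, e₀ p ≤ e ∧
      ∑ i, μ i = ⌈t * (((p : ℕ) : ℝ) ^ e - 1)⌉₊ ∧
        IsPureTwist (frobPow (p : ℕ) (Y.ring p) e) (φp p (∏ i, fp i p ^ μ i)) := by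
    filter_upwards [hS, hφp.1, hap.eventually_eq_span hf hfp, Y.eventually_isLocalRing]
      with p h1 ⟨ψ, hψ⟩ h3 h4
    obtain ⟨e, ⟨c, hc, hpure⟩, he⟩ := h1.exists_gt (e₀ p)
    have hspan : Ideal.span (φp p '' (ap p : Set (X.ring p))) =
        Ideal.span (Set.range fun i => φp p (fp i p)) := by
      rw [hψ, h3]
      change Ideal.map ψ _ = _
      rw [Ideal.map_span, ← Set.range_comp]
      rfl
    rw [hspan] at hc
    -- Locality of `S_p`, valid for almost all `p`, is what allows `c` to be replaced by a monomial.
    obtain ⟨μ, hμ, hμpure⟩ := hpure.exists_monomial hc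
    refine ⟨e, μ, he.le, hμ, ?_⟩
    simpa only [hψ, map_prod, map_pow] using hμpure
  have hex' : ∀ p : Nat.Primes, ∃ (e : ℕ) (μ : Fin n → ℕ), (∃ e : ℕ, ∃ μ : Fin n → ℕ, e₀ p ≤ e ∧
      ∑ i, μ i = ⌈t * (((p : ℕ) : ℝ) ^ e - 1)⌉₊ ∧
        IsPureTwist (frobPow (p : ℕ) (Y.ring p) e) (φp p (∏ i, fp i p ^ μ i))) → e₀ p ≤ e ∧
      ∑ i, μ i = ⌈t * (((p : ℕ) : ℝ) ^ e - 1)⌉₊ ∧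
        IsPureTwist (frobPow (p : ℕ) (Y.ring p) e) (φp p (∏ i, fp i p ^ μ i)) := by
    intro p
    by_cases h : ∃ e : ℕ, ∃ μ : Fin n → ℕ, e₀ p ≤ e ∧
      -- For the negligible set of `p` without a suitable pair, the exponents are set to `0`.
      ∑ i, μ i = ⌈t * (((p : ℕ) : ℝ) ^ e - 1)⌉₊ ∧
        IsPureTwist (frobPow (p : ℕ) (Y.ring p) e) (φp p (∏ i, fp i p ^ μ i))
    · obtain ⟨e, μ, h⟩ := h
      exact ⟨e, μ, fun _ => h⟩
    · exact ⟨0, 0, fun h' => absurd h' h⟩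
  choose e μ heμ using hex'
  refine ⟨(e : HyperNat F), ?_, fun i => ((fun p => μ p i : Nat.Primes → ℕ) : HyperNat F), ?_, ?_⟩
  · refine Germ.coe_le.2 ?_
    filter_upwards [hex] with p h using (heμ p h).1
  · rw [germ_coe_sum, hyperExponent_coe]
    refine Germ.coe_eq.2 ?_
    filter_upwards [hex] with p h using (heμ p h).2.1
  · simp only [← hfp]
    rw [prod_hyperPow]
    refine isPureTwist_frob_of_eventually hφ hφp ?_
    filter_upwards [hex] with p h using (heμ p h).2.2

theorem prod_hyperPow_mem {a : Ideal R} {ap : ∀ p, Ideal (X.ring p)}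
    (hap : IsIdealApprox X.toHull a ap) {n : ℕ} {f : Fin n → R}
    (hf : Ideal.span (Set.range f) = a) (μ : Fin n → HyperNat F) :
    ∏ i, hyperPow (X.toHull (f i)) (μ i) ∈ idealHyperPow ap (∑ i, μ i) := by
  obtain ⟨fp, hfp⟩ := exists_ulim_eq F fun i => X.toHull (f i)
  obtain ⟨μ, rfl⟩ : ∃ m : Fin n → Nat.Primes → ℕ, (fun i => (m i : HyperNat F)) = μ :=
    ⟨fun i => (μ i).out, funext fun i => Quotient.out_eq _⟩
  refine ⟨fun p => ∑ i, μ i p, fun p => ∏ i, fp i p ^ μ i p, germ_coe_sum _ _, ?_, ?_⟩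
  · simp only [← hfp]
    exact prod_hyperPow _ _ _
  · filter_upwards [hap.eventually_eq_span hf hfp] with p hp
    rw [← Finset.prod_pow_eq_pow_sum]
    refine Ideal.prod_mem_prod fun i _ => Ideal.pow_mem_pow ?_ _
    rw [hp]
    exact Ideal.subset_span ⟨i, rfl⟩

/-- Purity of monomials in generators of `𝔞` implies sharp ultra-`F`-purity. -/
theorem isSharplyUltraFPure_of_exists_pure_monomial {a : Ideal R} {ap : ∀ p, Ideal (X.ring p)}
    (hap : IsIdealApprox X.toHull a ap) {t : ℝ}
    (h : ∀ (n : ℕ) (f : Fin n → R), Ideal.span (Set.range f) = a →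
        ∀ ε₀ : HyperNat F, ∃ ε : HyperNat F, ε₀ ≤ ε ∧ ∃ μ : Fin n → HyperNat F,
          ∑ i, μ i = hyperExponent F t ε ∧
            IsPureTwist (X.frob ε) (∏ i, hyperPow (X.toHull (f i)) (μ i))) :
    X.IsSharplyUltraFPure ap t := by
  intro ε₀
  obtain ⟨n, f, -, hf, -, -⟩ := id hap
  obtain ⟨ε, hε, μ, hμ, hpure⟩ := h n f hf ε₀
  exact ⟨ε, hε, _, hμ ▸ prod_hyperPow_mem hap hf μ, hpure⟩

theorem isHomApprox_id : X.IsHomApprox X (RingHom.id R) fun _ => id :=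
  ⟨Eventually.of_forall fun _ => ⟨AlgHom.id _ _, rfl⟩, fun _ _ h => h⟩

end LocalApprox

/-! ### The main theorem -/

theorem isPureRingHom_id (A : Type u) [CommRing A] : IsPureRingHom (RingHom.id A) := by
  rw [IsPureRingHom, isPureTwist_iff]
  intro m k a v w hw
  exact ⟨w, fun i => by simpa using hw i⟩

theorem mainTheorem7
    (F : Ultrafilter Nat.Primes) (hF : (F : Filter Nat.Primes) ≤ Filter.cofinite)
    (α : Ulim F FpBar ≃+* ℂ)
    (R : Type u) [CommRing R] [IsLocalRing R] [IsReduced R] [Algebra ℂ R]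
    [Algebra.EssFiniteType ℂ R]
    (X : LocalApprox F α R)
    (a : Ideal R) (ha : ∃ c ∈ a, ∀ q ∈ minimalPrimes R, c ∉ q)
    (ap : ∀ p, Ideal (X.ring p)) (hap : IsIdealApprox X.toHull a ap)
    (t : ℝ) (ht : 0 < t) :
    ((∀ᶠ p : Nat.Primes in (F : Filter Nat.Primes), IsSharplyFPure (p : ℕ) (X.ring p) (ap p) t) →
      (∀ (n : ℕ) (f : Fin n → R), Ideal.span (Set.range f) = a →
        ∀ ε₀ : HyperNat F, ∃ ε : HyperNat F, ε₀ ≤ ε ∧ ∃ μ : Fin n → HyperNat F,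
          ∑ i, μ i = hyperExponent F t ε ∧
            IsPureTwist (X.frob ε) (∏ i, hyperPow (X.toHull (f i)) (μ i))) ∧
      X.IsSharplyUltraFPure ap t) ∧
    (∀ (S : Type v) [CommRing S] [IsLocalRing S] [IsReduced S] [Algebra ℂ S]
      [Algebra.EssFiniteType ℂ S] [Algebra R S] [IsScalarTower ℂ R S]
      [IsLocalHom (algebraMap R S)] (Y : LocalApprox F α S)
      (φp : ∀ p, X.ring p → Y.ring p),
      IsPureRingHom (algebraMap R S) → X.IsHomApprox Y (algebraMap R S) φp →
      (∀ᶠ p : Nat.Primes in (F : Filter Nat.Primes),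
        IsSharplyFPure (p : ℕ) (Y.ring p) (Ideal.span (φp p '' (ap p : Set (X.ring p)))) t) →
      X.IsSharplyUltraFPure ap t) := by
  constructor
  · intro h
    have hmono : ∀ (n : ℕ) (f : Fin n → R), Ideal.span (Set.range f) = a →
        ∀ ε₀ : HyperNat F, ∃ ε : HyperNat F, ε₀ ≤ ε ∧ ∃ μ : Fin n → HyperNat F,
          ∑ i, μ i = hyperExponent F t ε ∧
            IsPureTwist (X.frob ε) (∏ i, hyperPow (X.toHull (f i)) (μ i)) := by
      intro n f hf ε₀
      -- Part 1 is the descent statement for the identity of `R`, approximated by the identities of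
      -- the `R_p`.
      refine LocalApprox.exists_pure_monomial (isPureRingHom_id R) X.isHomApprox_id hap ?_ hf ε₀
      filter_upwards [h] with p hp
      rwa [Set.image_id, Ideal.span_eq]
    exact ⟨hmono, LocalApprox.isSharplyUltraFPure_of_exists_pure_monomial hap hmono⟩
  · intro S _ _ _ _ _ _ _ _ Y φp hpure hφp hS
    exact LocalApprox.isSharplyUltraFPure_of_exists_pure_monomial hap fun n f hf ε₀ =>
      LocalApprox.exists_pure_monomial hpure hφp hap hS hf ε₀
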